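/- Let $V$ be a finite-dimensional real inner product space and $\omega$ an alternating non-degenerate bilinear form on $V$. Let $\Gamma$ be a compact Lie group acting linearly and continuously on $V$ through $\rho:\Gamma\to GL(V)$, $\gamma x=\rho_\gamma x$, and let $\sigma_1,\sigma_2:\Gamma\to\mathbb Z_2=\{\pm1\}$ be group homomorphisms. Suppose the action is $\sigma_1$-semisymplectic, i.e. $\omega(\gamma u,\gamma v)=\sigma_1(\gamma)\,\omega(u,v)$ for all $\gamma\in\Gamma$, $u,v\in V$. Let $X:V\to V$ be an $\omega$-Hamiltonian vector field, i.e. $X=X_H$ for some smooth $H:V\to\mathbb R$, where $X_H$ is defined by $\omega(X_H(x),\cdot)=dH_x$; suppose $X$ is $\Gamma_{\sigma_2}$-equivariant, i.e. $X(\gamma x)=\sigma_2(\gamma)\,\gamma X(x)$ for all $\gamma\in\Gamma$, $x\in V$, and that $X(0)=0$. Put $L=dX_0$, let $L^T$ be the transpose of $L$ with respect to the inner product, and let $\mathbf S=\overline{\{e^{sL^T}:s\in\mathbb R\}}$ (closure in $GL(V)$). Assume that $\rho(\Gamma)$ normalizes $\mathbf S$, so that the semidirect product $\mathbf S\rtimes\Gamma$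 is defined and acts on $V$ by $(s,\gamma)x=s(\gamma x)$; this is automatic when the inner product is $\Gamma$-invariant, and a $\Gamma$-invariant inner product always exists. Let $\tilde\sigma_j:\mathbf S\rtimes\Gamma\to\mathbb Z_2$, $\tilde\sigma_j(s,\gamma)=\sigma_j(\gamma)$, for $j=1,2$, and let $\mathcal P^k_{\tilde\sigma_1\tilde\sigma_2}(\mathbf S\rtimes\Gamma)$ be the space of homogeneous polynomial functions $F:V\to\mathbb R$ of degree $k$ with $F(gx)=\tilde\sigma_1(g)\tilde\sigma_2(g)F(x)$ for all $g\in\mathbf S\rtimes\Gamma$ and $x\in V$. Suppose that $\mathbf S$ acts symplectically on $(V,\omega)$, i.e. $\omega(su,sv)=\omega(u,v)$ for all $s\in\mathbf S$, $u,v\in V$. Then for every $r$ there are $K^k\in\mathcal P^k_{\tilde\sigma_1\tilde\sigma_2}(\mathbf S\rtimes\Gamma)$, $k=3,\dots,r$, such that $X$ is formally conjugate, by a symplectic $\Gamma$-equivariant change of coordinates, to a vector field $$Y(y)=Ly+X_{K^3}(y)+\cdots+X_{K^r}(y)+O(|y|^r)\qquad (y\to0).$$ More precisely, there is a $C^\infty$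 diffeomorphism $\xi$ from a $\Gamma$-invariant open neighbourhood $U$ of $0$ onto an open neighbourhood of $0$, with $\xi(0)=0$, $d\xi_0=\mathrm{Id}$, $\xi^*\omega=\omega$ and $\xi(\gamma y)=\gamma\,\xi(y)$ for all $\gamma\in\Gamma$, $y\in U$, such that $d\xi_y\,Y(y)=X(\xi(y))$ for all $y\in U$. In particular, the Taylor series of $X$ and $Y$ at $0$ are conjugate as formal vector fields by the Taylor series of $\xi$. Moreover, both $Y$ (on $U$) and the truncated normal form $y\mapsto Ly+X_{K^3}(y)+\cdots+X_{K^r}(y)$ (on $V$) are $\omega$-Hamiltonian and $\Gamma_{\sigma_2}$-equivariant. -/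

import Mathlib

open scoped Manifold Topology

noncomputable section

namespace HamNormalForm

/-- The topological group `GL(V)` of invertible (continuous) linear operators of `V`. -/
abbrev GLV (V : Type*) [NormedAddCommGroup V] [InnerProductSpace ℝ V] : Type _ :=
  (V →L[ℝ] V)ˣ

section Symmetry

variable {V : Type*} [NormedAddCommGroup V] [InnerProductSpace ℝ V]
variable {G : Type*} [Group G]

/-- The linear action of `G` on `V` given by `θ : G → GL(V)` is `σ`-semisymplectic:
`ω(g u, g v) = σ(g) ω(u, v)`.  Here `ℤ₂ = {1, -1} = ℤˣ`. -/
def IsSemisymplectic (ω : LinearMap.BilinForm ℝ V) (θ : G →* GLV V) (σ : G →* ℤˣ) : Prop :=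
  ∀ (g : G) (u v : V),
    ω ((θ g : V →L[ℝ] V) u) ((θ g : V →L[ℝ] V) v) = (((σ g : ℤˣ) : ℤ) : ℝ) * ω u v

/-- The action is symplectic: the case of the trivial homomorphism. -/
def IsSymplecticAction (ω : LinearMap.BilinForm ℝ V) (θ : G →* GLV V) : Prop :=
  IsSemisymplectic ω θ 1

/-- `X` is a `G_σ`-equivariant vector field on `U`: `X(g x) = σ(g) g X(x)` for all `g ∈ G`
and `x ∈ U` (used for `G`-invariant `U`). -/
def IsEquivariantOn (θ : G →* GLV V) (σ : G →* ℤˣ) (X : V → V) (U : Set V) : Prop :=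
  ∀ (g : G), ∀ x ∈ U,
    X ((θ g : V →L[ℝ] V) x) = (((σ g : ℤˣ) : ℤ) : ℝ) • (θ g : V →L[ℝ] V) (X x)

/-- `F` is a homogeneous polynomial function of degree `k` on `V`, that is, the restriction to the
diagonal of a `k`-linear form. -/
def IsHomogeneousPoly (k : ℕ) (F : V → ℝ) : Prop :=
  ∃ M : ContinuousMultilinearMap ℝ (fun _ : Fin k => V) ℝ, ∀ x, F x = M fun _ => x

/-- `𝒫ᵏ_σ(G)`: the homogeneous polynomial functions `F` of degree `k` with
`F(g x) = σ(g) F(x)` for all `g ∈ G`, `x ∈ V`. -/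
def invariantPoly (k : ℕ) (θ : G →* GLV V) (σ : G →* ℤˣ) : Set (V → ℝ) :=
  {F | IsHomogeneousPoly k F ∧
    ∀ (g : G) (x : V), F ((θ g : V →L[ℝ] V) x) = (((σ g : ℤˣ) : ℤ) : ℝ) * F x}

end Symmetry

section Hamiltonian

variable {V : Type*} [NormedAddCommGroup V] [InnerProductSpace ℝ V] [FiniteDimensional ℝ V]

/-- `X` is an `ω`-Hamiltonian vector field on the open set `U`: there is a smooth
`H : U → ℝ` with `ω(X(x), ·) = dH_x` for all `x ∈ U`. -/
def IsHamiltonianOn (ω : LinearMap.BilinForm ℝ V) (X : V → V) (U : Set V) : Prop :=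
  ∃ H : V → ℝ, ContDiffOn ℝ (⊤ : ℕ∞) H U ∧ ∀ x ∈ U, ∀ v : V, ω (X x) v = fderiv ℝ H x v

/-- The `ω`-Hamiltonian vector field `X_H` of a function `H : V → ℝ`: the unique vector field
with `ω(X_H(x), ·) = dH_x`. -/
def hamiltonianVF (ω : LinearMap.BilinForm ℝ V) (hω : ω.Nondegenerate) (H : V → ℝ) (x : V) : V :=
  (ω.toDual hω).symm (fderiv ℝ H x : V →ₗ[ℝ] ℝ)

theorem apply_hamiltonianVF (ω : LinearMap.BilinForm ℝ V) (hω : ω.Nondegenerate) (H : V → ℝ)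
    (x v : V) : ω (hamiltonianVF ω hω H x) v = fderiv ℝ H x v := by
  rw [hamiltonianVF, ← LinearMap.BilinForm.toDual_def hω, LinearEquiv.apply_symm_apply]
  rfl

/-- The transpose `Lᵀ` of `L` with respect to the inner product of `V`. -/
def transposeOp (L : V →L[ℝ] V) : V →L[ℝ] V :=
  letI := FiniteDimensional.complete ℝ V
  ContinuousLinearMap.adjoint L

/-- The one-parameter group `s ↦ e^{s A}`, as a homomorphism from `(ℝ, +)` to `GL(V)`. -/
def expHom (A : V →L[ℝ] V) : Multiplicative ℝ →* GLV V :=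
  MonoidHom.toHomUnits
    { toFun := fun s => NormedSpace.exp (Multiplicative.toAdd s • A)
      map_one' := by simp
      map_mul' := fun s t => by
        have := FiniteDimensional.complete ℝ V
        rw [toAdd_mul, add_smul]
        let _ := NormedAlgebra.restrictScalars ℚ ℝ (V →L[ℝ] V)
        exact NormedSpace.exp_add_of_commute
          (((Commute.refl A).smul_left _).smul_right _) }

theorem coe_expHom (A : V →L[ℝ] V) (s : Multiplicative ℝ) :
    (expHom A s : V →L[ℝ] V) = NormedSpace.exp (Multiplicative.toAdd s • A) := rfl

/-- The group `𝐒`, the closure of `{e^{s Lᵀ} : s ∈ ℝ}` in `GL(V)`. -/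
def groupS (L : V →L[ℝ] V) : Subgroup (GLV V) :=
  (expHom (transposeOp L)).range.topologicalClosure

variable {Γ : Type*} [Group Γ]

/-- The action of `Γ` on `𝐒` by conjugation, `γ ↦ (s ↦ ρ_γ s ρ_γ⁻¹)`, when `Γ` normalizes `𝐒`. -/
def conjAction (ρ : Γ →* GLV V) (L : V →L[ℝ] V)
    (hS : ∀ γ, ρ γ ∈ Subgroup.normalizer (groupS L : Set (GLV V))) :
    Γ →* MulAut (groupS L) :=
  (groupS L).normalizerMonoidHom.comp
    (ρ.codRestrict (Subgroup.normalizer (groupS L : Set (GLV V))) hS)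

/-- The semidirect product `𝐒 ⋊ Γ`. -/
abbrev SemidirectS (ρ : Γ →* GLV V) (L : V →L[ℝ] V)
    (hS : ∀ γ, ρ γ ∈ Subgroup.normalizer (groupS L : Set (GLV V))) : Type _ :=
  groupS L ⋊[conjAction ρ L hS] Γ

/-- The linear action of `𝐒 ⋊ Γ` on `V`, `(s, γ) x = s (γ x)`. -/
def semidirectAction (ρ : Γ →* GLV V) (L : V →L[ℝ] V)
    (hS : ∀ γ, ρ γ ∈ Subgroup.normalizer (groupS L : Set (GLV V))) :
    SemidirectS ρ L hS →* GLV V :=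
  SemidirectProduct.lift (groupS L).subtype ρ (fun _ => by ext; rfl)

theorem semidirectAction_apply (ρ : Γ →* GLV V) (L : V →L[ℝ] V)
    (hS : ∀ γ, ρ γ ∈ Subgroup.normalizer (groupS L : Set (GLV V)))
    (p : SemidirectS ρ L hS) :
    semidirectAction ρ L hS p = (p.left : GLV V) * ρ p.right := rfl

/-- The homomorphism `σ̃ : 𝐒 ⋊ Γ → ℤ₂`, `σ̃(s, γ) = σ(γ)`. -/
def tildeHom (ρ : Γ →* GLV V) (L : V →L[ℝ] V)
    (hS : ∀ γ, ρ γ ∈ Subgroup.normalizer (groupS L : Set (GLV V))) (σ : Γ →* ℤˣ) :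
    SemidirectS ρ L hS →* ℤˣ :=
  σ.comp SemidirectProduct.rightHom

/-- If `Γ` acts orthogonally and `L γ = σ(γ) γ L` (as for the linearization of a
`Γ_σ`-equivariant vector field), then `γ e^{s Lᵀ} γ⁻¹ = e^{σ(γ) s Lᵀ}`. -/
theorem conj_expHom (ρ : Γ →* GLV V) (σ : Γ →* ℤˣ) (L : V →L[ℝ] V)
    (hρ : ∀ γ x, ‖(ρ γ : V →L[ℝ] V) x‖ = ‖x‖)
    (hL : ∀ γ x, L ((ρ γ : V →L[ℝ] V) x) =
      (((σ γ : ℤˣ) : ℤ) : ℝ) • (ρ γ : V →L[ℝ] V) (L x))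
    (γ : Γ) (s : ℝ) :
    ρ γ * expHom (transposeOp L) (Multiplicative.ofAdd s) * (ρ γ)⁻¹ =
      expHom (transposeOp L) (Multiplicative.ofAdd ((((σ γ : ℤˣ) : ℤ) : ℝ) * s)) := by
  have := FiniteDimensional.complete ℝ V
  set c : ℝ := (((σ γ : ℤˣ) : ℤ) : ℝ) with hc
  have hin : ∀ x y, inner ℝ ((ρ γ : V →L[ℝ] V) x) ((ρ γ : V →L[ℝ] V) y) = inner ℝ x y :=
    (LinearMap.norm_map_iff_inner_map_map (𝕜 := ℝ) (ρ γ : V →L[ℝ] V)).1 (hρ γ)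
  have key : (ρ γ : V →L[ℝ] V) * transposeOp L * ((ρ γ)⁻¹ : GLV V) = c • transposeOp L := by
    rw [Units.mul_inv_eq_iff_eq_mul]
    ext x
    refine ext_inner_right ℝ fun z => ?_
    obtain ⟨y, rfl⟩ : ∃ y, (ρ γ : V →L[ℝ] V) y = z :=
      ⟨(((ρ γ)⁻¹ : GLV V) : V →L[ℝ] V) z, by
        exact congrArg (fun T : V →L[ℝ] V => T z) (Units.mul_inv (ρ γ))⟩
    change inner ℝ ((ρ γ : V →L[ℝ] V) (transposeOp L x)) _ =
      inner ℝ (c • transposeOp L ((ρ γ : V →L[ℝ] V) x)) _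
    rw [hin, inner_smul_left]
    unfold transposeOp
    rw [ContinuousLinearMap.adjoint_inner_left, ContinuousLinearMap.adjoint_inner_left, hL,
      inner_smul_right, hin]
    have hcc : c * c = 1 := by
      rw [hc]; norm_cast; exact Int.units_coe_mul_self _
    simp only [conj_trivial]
    rw [← hc, ← mul_assoc, hcc, one_mul]
  let _ := NormedAlgebra.restrictScalars ℚ ℝ (V →L[ℝ] V)
  ext1
  rw [Units.val_mul, Units.val_mul, coe_expHom, coe_expHom, ← NormedSpace.exp_units_conj]
  congr 1
  simp only [toAdd_ofAdd]
  rw [mul_smul_comm, smul_mul_assoc, key, smul_smul, mul_comm]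

/-- If the inner product that defines the transpose is `Γ`-invariant and `L γ = σ(γ) γ L`, then
`Γ` normalizes `𝐒`, so that `𝐒 ⋊ Γ` is defined. -/
theorem mem_normalizer_groupS (ρ : Γ →* GLV V) (σ : Γ →* ℤˣ) (L : V →L[ℝ] V)
    (hρ : ∀ γ x, ‖(ρ γ : V →L[ℝ] V) x‖ = ‖x‖)
    (hL : ∀ γ x, L ((ρ γ : V →L[ℝ] V) x) =
      (((σ γ : ℤˣ) : ℤ) : ℝ) • (ρ γ : V →L[ℝ] V) (L x))
    (γ : Γ) : ρ γ ∈ Subgroup.normalizer (groupS L : Set (GLV V)) := by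
  have main : ∀ (γ : Γ) (g : GLV V), g ∈ groupS L → ρ γ * g * (ρ γ)⁻¹ ∈ groupS L := by
    intro γ g hg
    have hcont : Continuous fun g : GLV V => ρ γ * g * (ρ γ)⁻¹ := by fun_prop
    refine map_mem_closure (f := fun g : GLV V => ρ γ * g * (ρ γ)⁻¹) hcont hg ?_
    rintro _ ⟨s, rfl⟩
    exact ⟨_, (conj_expHom ρ σ L hρ hL γ s.toAdd).symm⟩
  rw [Subgroup.mem_normalizer_iff]
  refine fun g => ⟨main γ g, fun h => ?_⟩
  have := main γ⁻¹ _ h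
  simpa [mul_assoc] using this

/-- `ξ` is a smooth symplectic `Γ`-equivariant change of coordinates `x = ξ(y) = y + O(|y|²)` near
the origin: a smooth diffeomorphism from a `Γ`-invariant open neighbourhood of `0` (its source)
onto an open neighbourhood of `0` (its target). -/
structure IsSymplecticEquivariantChange (ω : LinearMap.BilinForm ℝ V) (ρ : Γ →* GLV V)
    (ξ : OpenPartialHomeomorph V V) : Prop where
  zero_mem : (0 : V) ∈ ξ.source
  map_zero : ξ 0 = 0
  contDiffOn : ContDiffOn ℝ (⊤ : ℕ∞) ξ ξ.source
  contDiffOn_symm : ContDiffOn ℝ (⊤ : ℕ∞) ξ.symm ξ.target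
  fderiv_zero : fderiv ℝ ξ 0 = ContinuousLinearMap.id ℝ V
  symplectic : ∀ y ∈ ξ.source, ∀ u v : V, ω (fderiv ℝ ξ y u) (fderiv ℝ ξ y v) = ω u v
  invariant : ∀ γ, ∀ y ∈ ξ.source, (ρ γ : V →L[ℝ] V) y ∈ ξ.source
  equivariant : ∀ γ, ∀ y ∈ ξ.source,
    ξ ((ρ γ : V →L[ℝ] V) y) = (ρ γ : V →L[ℝ] V) (ξ y)

/-- The vector fields `X` and `Y` are conjugate by the change of coordinates `x = ξ(y)`:
`Y = ξ⁻¹_* X`, that is, `dξ_y Y(y) = X(ξ(y))` on the source of `ξ`.  In particular the Taylor series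
of `X` and `Y` at the origin are conjugate, as formal vector fields, by the Taylor series of `ξ`. -/
def IsConjugateBy (ξ : OpenPartialHomeomorph V V) (X Y : V → V) : Prop :=
  ∀ y ∈ ξ.source, fderiv ℝ ξ y (Y y) = X (ξ y)

/-- The truncated vector field `L y + X_{K³}(y) + ⋯ + X_{Kʳ}(y)`. -/
def truncatedVF (ω : LinearMap.BilinForm ℝ V) (hω : ω.Nondegenerate) (L : V →L[ℝ] V)
    (K : ℕ → V → ℝ) (r : ℕ) (y : V) : V :=
  L y + ∑ k ∈ Finset.Icc 3 r, hamiltonianVF ω hω (K k) y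

end Hamiltonian

end HamNormalForm

end

/-! Write `X = X_H` with `H 0 = 0`; then `H` is multiplied by `σ₁ σ₂` under `Γ`, and it suffices to
normalize the function `H` by a symplectic equivariant map. No flow is needed: a function `F =
O(|x|³)` generates the midpoint map `ξ = B ∘ A⁻¹`, where `A x = x - X_F(x)/2` and `B x = x +
X_F(x)/2`. Its derivative is the Cayley transform of an infinitesimally symplectic operator, hence
symplectic. If `F` is multiplied by `σ₁` under `Γ`, then `X_F` and `ξ` are equivariant.

Put `N x = ω(L x, x)/2 + K³(x) + ⋯ + Kʳ(x)`. The condition `H ∘ ξ - N = O(|y|^{r+1})` becomes `H ∘ B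
- N ∘ A = O(|x|^{r+1})` after the substitution `y = A x`, so no inverse map enters the induction on
`r` (`exists_generatingFunction`). If `P` is the leading term of the error, of degree `r+1`, then
adding `f` to `F` and `Q` to `N` changes it to `P - df(L x) - Q`.

The equation `P = df(L x) + Q` is solved in two moves. For the inner product on forms given by
coordinates in an orthonormal basis, the derivation induced by `L` has as adjoint the derivation
induced by `Lᵀ` (`inner_formCoord_lieDeriv`). So `Q` can be taken in the kernel of the latter, which
makes it `𝐒`-invariant. Averaging over `Γ` then gives `f` and `Q` the right symmetry
(`exists_homological`); `Q` stays `𝐒`-invariant because `Γ` normalizes `𝐒`.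

Finally, differentiating `H ∘ ξ - N` costs one power and gives the remainder `O(|y|^r)` of the
vector field. -/

namespace HamNormalForm

open Filter Asymptotics MeasureTheory

/-! ### Taylor expansion and orders of vanishing at the origin -/

section Taylor

theorem isBigO_norm_pow_of_le {E : Type*} [NormedAddCommGroup E] {m n : ℕ} (h : m ≤ n) :
    (fun x : E => ‖x‖ ^ n) =O[𝓝 0] fun x => ‖x‖ ^ m := by
  refine .of_bound 1 ?_
  filter_upwards [Metric.ball_mem_nhds (0 : E) one_pos] with x hx
  rw [mem_ball_zero_iff] at hx
  simpa using pow_le_pow_of_le_one (norm_nonneg x) hx.le h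

variable {E F : Type*} [NormedAddCommGroup E] [NormedSpace ℝ E]
  [NormedAddCommGroup F] [NormedSpace ℝ F]

/-- The value at the diagonal of the multilinear map `M` scales as a homogeneous polynomial. -/
theorem map_diag_smul {n : ℕ} (M : E [×n]→L[ℝ] F) (t : ℝ) (x : E) :
    M (fun _ => t • x) = t ^ n • M fun _ => x := by
  simpa using M.map_smul_univ (fun _ => t) (fun _ => x)

theorem continuous_diag {n : ℕ} (M : E [×n]→L[ℝ] F) : Continuous fun x => M fun _ => x :=
  M.cont.comp (continuous_pi fun _ => continuous_id)

theorem isBigO_diag {n : ℕ} (M : E [×n]→L[ℝ] F) (l : Filter E) :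
    (fun x => M fun _ => x) =O[l] fun x => ‖x‖ ^ n :=
  .of_bound ‖M‖ <| .of_forall fun x => by simpa using M.le_opNorm fun _ => x

/-- The top term is itself one order smaller than the lower ones, so dropping it lets induction kill
those; what remains, divided by its power of `t`, tends to zero. -/
theorem coeff_eq_zero_of_isBigO {n : ℕ} {a : ℕ → F}
    (h : (fun t : ℝ => ∑ k ∈ Finset.range n, t ^ k • a k) =O[𝓝[>] 0] fun t => t ^ n) :
    ∀ k < n, a k = 0 := by
  induction n with
  | zero => simp
  | succ n ih =>
    have hn : (fun t : ℝ => t ^ n • a n) =O[𝓝[>] 0] fun t => t ^ n :=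
      .of_bound ‖a n‖ <| .of_forall fun t => by rw [norm_smul, mul_comm]
    have hpow : (fun t : ℝ => t ^ (n + 1)) =O[𝓝[>] 0] fun t => t ^ n := by
      refine (IsBigO.of_bound 1 ?_)
      filter_upwards [Ioo_mem_nhdsGT (zero_lt_one' ℝ)] with t ht
      rw [one_mul, norm_pow, norm_pow, Real.norm_of_nonneg ht.1.le]
      exact pow_le_pow_of_le_one ht.1.le ht.2.le n.le_succ
    have hlow : ∀ k < n, a k = 0 := ih <| by
      refine ((h.trans hpow).sub hn).congr_left fun t => ?_
      rw [Finset.sum_range_succ, add_sub_cancel_right]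
    have htop : (fun t : ℝ => t ^ n • a n) =O[𝓝[>] 0] fun t => t ^ (n + 1) := by
      refine h.congr_left fun t => ?_
      rw [Finset.sum_range_succ, Finset.sum_eq_zero, zero_add]
      exact fun k hk => by rw [hlow k (Finset.mem_range.1 hk), smul_zero]
    obtain ⟨C, hC⟩ := htop.bound
    have hle : ‖a n‖ ≤ 0 := by
      have h0 : Tendsto (fun t : ℝ => C * t) (𝓝[>] 0) (𝓝 0) := by
        have : Tendsto (fun t : ℝ => C * t) (𝓝 0) (𝓝 (C * 0)) := by
          exact (continuous_const.mul continuous_id).tendsto _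
        simpa using this.mono_left nhdsWithin_le_nhds
      refine ge_of_tendsto h0 ?_
      filter_upwards [hC, self_mem_nhdsWithin] with t ht ht0
      have htp : 0 < t ^ n := pow_pos ht0 n
      rw [norm_smul, norm_pow, norm_pow, Real.norm_of_nonneg (le_of_lt ht0), pow_succ] at ht
      refine le_of_mul_le_mul_left ?_ htp
      linarith
    intro k hk
    rcases Nat.lt_succ_iff_lt_or_eq.1 hk with h | rfl
    · exact hlow k h
    · exact norm_le_zero_iff.1 hle

/-- Taylor's formula at the origin with a remainder `O(‖x‖ ^ (n + 1))`. -/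
theorem taylor_isBigO [CompleteSpace F] {f : E → F} (hf : ContDiffAt ℝ (⊤ : ℕ∞) f 0) (n : ℕ) :
    (fun x => f x - ∑ k ∈ Finset.range (n + 1),
      (k.factorial : ℝ)⁻¹ • iteratedFDeriv ℝ k f 0 fun _ => x) =O[𝓝 0] fun x => ‖x‖ ^ (n + 1) := by
  have hf' : ContDiffAt ℝ ((n + 1 : ℕ) : WithTop ℕ∞) f 0 := hf.of_le (by exact_mod_cast le_top)
  have hcont : ContinuousAt (iteratedFDeriv ℝ (n + 1) f) 0 :=
    (hf'.iteratedFDeriv_right (m := 0) (by simp)).continuousAt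
  have hbd : ∀ᶠ x in 𝓝 (0 : E),
      ‖iteratedFDeriv ℝ (n + 1) f x‖ < ‖iteratedFDeriv ℝ (n + 1) f 0‖ + 1 :=
    hcont.norm.eventually_lt continuousAt_const (by simp)
  obtain ⟨ε, hε, hball⟩ := Metric.eventually_nhds_iff_ball.1
    ((hf'.eventually (by simp)).and hbd)
  set C := ‖iteratedFDeriv ℝ (n + 1) f 0‖ + 1
  refine .of_bound (C * ‖(n.factorial : ℝ)⁻¹‖) ?_
  filter_upwards [Metric.ball_mem_nhds (0 : E) hε] with y hy
  have hmem : ∀ t ∈ Set.Icc (0 : ℝ) 1, t • y ∈ Metric.ball (0 : E) ε := fun t ht => by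
    rw [mem_ball_zero_iff] at hy ⊢
    rw [norm_smul, Real.norm_of_nonneg ht.1]
    exact (mul_le_of_le_one_left (norm_nonneg y) ht.2).trans_lt hy
  have key := map_add_eq_sum_add_integral_iteratedFDeriv (f := f) (x := 0) (y := y) (n := n)
    (fun t ht => by
      rw [zero_add]
      exact_mod_cast (hball _ (hmem t ht)).1)
  simp only [zero_add] at key
  rw [key, add_sub_cancel_left, norm_smul]
  have hint := intervalIntegral.norm_integral_le_of_norm_le_const (a := 0) (b := 1)
    (C := C * ‖y‖ ^ (n + 1))
    (f := fun t : ℝ => (1 - t) ^ n • iteratedFDeriv ℝ (n + 1) f (t • y) fun _ => y) (by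
      intro t ht
      rw [Set.uIoc_of_le zero_le_one] at ht
      have ht' : t ∈ Set.Icc (0 : ℝ) 1 := ⟨ht.1.le, ht.2⟩
      have h1 : ‖(1 - t) ^ n‖ ≤ 1 := by
        rw [norm_pow, Real.norm_of_nonneg (by linarith [ht.2])]
        exact pow_le_one₀ (by linarith [ht.2]) (by linarith [ht.1])
      have h2 : ‖iteratedFDeriv ℝ (n + 1) f (t • y) fun _ => y‖ ≤ C * ‖y‖ ^ (n + 1) := by
        refine ((iteratedFDeriv ℝ (n + 1) f (t • y)).le_opNorm _).trans ?_
        simp only [Finset.prod_const, Finset.card_univ, Fintype.card_fin]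
        gcongr
        exact (hball _ (hmem t ht')).2.le
      rw [norm_smul]
      exact (mul_le_of_le_one_left (norm_nonneg _) h1).trans h2)
  rw [sub_zero, abs_one, mul_one] at hint
  calc _ ≤ ‖(n.factorial : ℝ)⁻¹‖ * (C * ‖y‖ ^ (n + 1)) := by gcongr
    _ = _ := by rw [norm_pow, norm_norm]; ring

/-- The lowest-order Taylor term of a smooth function that is `O(‖x‖ ^ n)` at the origin. -/
theorem exists_diag_isBigO [CompleteSpace F] {f : E → F} (hf : ContDiffAt ℝ (⊤ : ℕ∞) f 0) {n : ℕ}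
    (h : f =O[𝓝 0] fun x => ‖x‖ ^ n) :
    ∃ M : E [×n]→L[ℝ] F, (fun x => f x - M fun _ => x) =O[𝓝 0] fun x => ‖x‖ ^ (n + 1) := by
  have hT := taylor_isBigO hf n
  have hsum : (fun x => ∑ k ∈ Finset.range n,
      (k.factorial : ℝ)⁻¹ • iteratedFDeriv ℝ k f 0 fun _ => x) =O[𝓝 0] fun x => ‖x‖ ^ n := by
    have hM := isBigO_diag ((n.factorial : ℝ)⁻¹ • iteratedFDeriv ℝ n f 0) (𝓝 0)
    refine ((h.sub (hT.trans (isBigO_norm_pow_of_le n.le_succ))).sub hM).congr_left fun x => ?_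
    rw [Finset.sum_range_succ]
    simp
  -- Along each ray `t ↦ t • x` the Taylor polynomial is a polynomial in `t`, so its low
  -- coefficients vanish.
  have hzero : ∀ x : E, ∀ k < n, (k.factorial : ℝ)⁻¹ • iteratedFDeriv ℝ k f 0 (fun _ => x) = 0 := by
    intro x
    refine coeff_eq_zero_of_isBigO ?_
    have htend : Tendsto (fun t : ℝ => t • x) (𝓝[>] 0) (𝓝 0) := by
      have : Tendsto (fun t : ℝ => t • x) (𝓝 0) (𝓝 ((0 : ℝ) • x)) :=
        (continuous_id.smul continuous_const).tendsto _
      rw [zero_smul] at this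
      exact this.mono_left nhdsWithin_le_nhds
    refine ((hsum.comp_tendsto htend).congr_left (f₂ := fun t : ℝ => ∑ k ∈ Finset.range n,
      t ^ k • (k.factorial : ℝ)⁻¹ • iteratedFDeriv ℝ k f 0 fun _ => x) fun t => ?_).trans ?_
    · refine Finset.sum_congr rfl fun k _ => ?_
      rw [map_diag_smul, smul_comm]
    · refine .of_bound (‖x‖ ^ n) (.of_forall fun t => ?_)
      simp [norm_smul, mul_pow, mul_comm]
  refine ⟨(n.factorial : ℝ)⁻¹ • iteratedFDeriv ℝ n f 0, hT.congr_left fun x => ?_⟩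
  rw [Finset.sum_range_succ, Finset.sum_eq_zero fun k hk => hzero x k (Finset.mem_range.1 hk)]
  simp

theorem contDiffAt_fderiv {f : E → F} {x : E} (hf : ContDiffAt ℝ (⊤ : ℕ∞) f x) :
    ContDiffAt ℝ (⊤ : ℕ∞) (fderiv ℝ f) x :=
  hf.fderiv_right (by norm_cast)

/-- The derivative of a smooth function that is `O(‖x‖ ^ (n + 1))` is `O(‖x‖ ^ n)`. -/
theorem fderiv_isBigO [CompleteSpace F] {f : E → F} (hf : ContDiffAt ℝ (⊤ : ℕ∞) f 0) {n : ℕ}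
    (h : f =O[𝓝 0] fun x => ‖x‖ ^ (n + 1)) :
    fderiv ℝ f =O[𝓝 0] fun x => ‖x‖ ^ n := by
  suffices H : ∀ m ≤ n, fderiv ℝ f =O[𝓝 0] fun x => ‖x‖ ^ m from H n le_rfl
  have hdf := contDiffAt_fderiv hf
  intro m
  induction m with
  | zero =>
    intro _
    simpa using hdf.continuousAt.isBigO_one ℝ
  | succ m ih =>
    intro hmn
    obtain ⟨P, hP⟩ := exists_diag_isBigO hdf (ih (by omega))
    -- The exponent improves by one once the leading term `P` of `df` vanishes. The rescalings
    -- `t^{-(m+1)} f(t y)` tend to `0`, while their derivatives tend uniformly to `P` on the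
    -- diagonal; hence `P` is the derivative of the zero function.
    suffices hP0 : ∀ z ∈ Metric.ball (0 : E) 1, (P fun _ => z) = 0 by
      refine hP.congr' ?_ .rfl
      filter_upwards [Metric.ball_mem_nhds (0 : E) one_pos] with z hz
      rw [hP0 z hz, sub_zero]
    have hfm : f =O[𝓝 0] fun x => ‖x‖ ^ (m + 2) := h.trans (isBigO_norm_pow_of_le (by omega))
    obtain ⟨C, hC⟩ := hfm.bound
    obtain ⟨D, hD⟩ := hP.bound
    have hdiff : ∀ᶠ x in 𝓝 (0 : E), DifferentiableAt ℝ f x :=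
      ((hf.of_le (m := 1) (by norm_cast)).eventually (by simp)).mono
        fun x hx => hx.differentiableAt (by simp)
    obtain ⟨ε, hε, hball⟩ := Metric.eventually_nhds_iff_ball.1 (hC.and (hD.and hdiff))
    intro z hz
    have hsmall : ∀ t ∈ Set.Ioo (0 : ℝ) ε, ∀ y ∈ Metric.ball (0 : E) 1,
        t • y ∈ Metric.ball (0 : E) ε := fun t ht y hy => by
      rw [mem_ball_zero_iff] at hy ⊢
      rw [norm_smul, Real.norm_of_nonneg ht.1.le]
      exact (mul_le_of_le_one_right ht.1.le hy.le).trans_lt ht.2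
    have hlin : ∀ c : ℝ, Tendsto (fun t : ℝ => c * t) (𝓝[>] 0) (𝓝 0) := fun c => by
      have : Tendsto (fun t : ℝ => c * t) (𝓝 0) (𝓝 (c * 0)) :=
        (continuous_const.mul continuous_id).tendsto _
      simpa using this.mono_left nhdsWithin_le_nhds
    have hder : HasFDerivAt (fun _ : E => (0 : F)) (P fun _ => z) z := by
      refine hasFDerivAt_of_tendstoUniformlyOnFilter (l := 𝓝[>] (0 : ℝ))
        (f := fun t y => (t ^ (m + 1))⁻¹ • f (t • y))
        (f' := fun t y => (t ^ m)⁻¹ • fderiv ℝ f (t • y)) (g' := fun y => P fun _ => y) ?_ ?_ ?_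
      · rw [Metric.tendstoUniformlyOnFilter_iff]
        intro δ hδ
        have h1 : ∀ᶠ t : ℝ in 𝓝[>] 0, |D| * t < δ := (hlin |D|).eventually_lt_const hδ
        have h2 := (h1.and (Ioo_mem_nhdsGT hε)).prod_mk (Metric.isOpen_ball.mem_nhds hz)
        filter_upwards [h2] with ⟨t, y⟩ ⟨⟨h1, ht⟩, hy⟩
        have hb := (hball _ (hsmall t ht y hy)).2.1
        simp only at h1 ht hy ⊢
        have ht0 : 0 < t := ht.1
        have hy1 : ‖y‖ ≤ 1 := (mem_ball_zero_iff.1 hy).le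
        rw [dist_comm, dist_eq_norm]
        rw [map_diag_smul] at hb
        have hE : (t ^ m)⁻¹ • fderiv ℝ f (t • y) - (P fun _ => y) =
            (t ^ m)⁻¹ • (fderiv ℝ f (t • y) - t ^ m • P fun _ => y) := by
          rw [smul_sub, inv_smul_smul₀ (pow_pos ht0 m).ne']
        rw [hE, norm_smul, norm_inv, norm_pow, Real.norm_of_nonneg ht0.le]
        rw [norm_pow, norm_norm, norm_smul, Real.norm_of_nonneg ht0.le] at hb
        calc _ ≤ (t ^ m)⁻¹ * (|D| * (t * 1) ^ (m + 1)) := by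
              gcongr
              refine hb.trans ?_
              gcongr
              exact le_abs_self D
          _ = |D| * t := by field_simp; ring
          _ < δ := h1
      · have h2 := (Filter.Eventually.prod_mk (Ioo_mem_nhdsGT hε)
          (Metric.isOpen_ball.mem_nhds hz) :)
        filter_upwards [h2] with ⟨t, y⟩ ⟨ht, hy⟩
        have hd := (hball _ (hsmall t ht y hy)).2.2.hasFDerivAt
        have hc := (hd.comp y ((hasFDerivAt_id y).const_smul t)).const_smul (t ^ (m + 1))⁻¹
        refine hc.congr_fderiv ?_
        ext v
        have ht0 : t ≠ 0 := (ht.1 : (0:ℝ) < t).ne'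
        simp only [smul_apply, ContinuousLinearMap.comp_apply,
          ContinuousLinearMap.id_apply, map_smul, smul_smul]
        congr 1
        field_simp
        ring
      · filter_upwards [Metric.isOpen_ball.mem_nhds hz] with y hy
        refine squeeze_zero_norm' ?_ (hlin |C|)
        filter_upwards [Ioo_mem_nhdsGT hε] with t ht
        have hb := (hball _ (hsmall t ht y hy)).1
        have ht0 : 0 < t := ht.1
        have hy1 : ‖y‖ ≤ 1 := (mem_ball_zero_iff.1 hy).le
        rw [norm_smul, norm_inv, norm_pow, Real.norm_of_nonneg ht0.le]
        rw [norm_pow, norm_norm, norm_smul, Real.norm_of_nonneg ht0.le] at hb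
        calc _ ≤ (t ^ (m + 1))⁻¹ * (|C| * (t * 1) ^ (m + 2)) := by
              gcongr
              refine hb.trans ?_
              gcongr
              exact le_abs_self C
          _ = |C| * t := by field_simp; ring
    exact hder.unique (hasFDerivAt_const (0 : F) z)

end Taylor

/-! ### The homological operator on forms and its adjoint -/

section LieDeriv

variable {V : Type*} [NormedAddCommGroup V] [InnerProductSpace ℝ V]

/-- The derivation of `k`-linear forms induced by a linear operator `A`. -/
noncomputable def lieDeriv {k : ℕ} (A : V →L[ℝ] V) :
    (V [×k]→L[ℝ] ℝ) →ₗ[ℝ] (V [×k]→L[ℝ] ℝ) where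
  toFun M := ∑ i, M.compContinuousLinearMap
    (Function.update (fun _ => ContinuousLinearMap.id ℝ V) i A)
  map_add' M N := by
    rw [← Finset.sum_add_distrib]
    rfl
  map_smul' c M := by
    rw [Finset.smul_sum]
    rfl

theorem lieDeriv_apply {k : ℕ} (A : V →L[ℝ] V) (M : V [×k]→L[ℝ] ℝ) (v : Fin k → V) :
    lieDeriv A M v = ∑ i, M (Function.update v i (A (v i))) := by
  rw [lieDeriv, LinearMap.coe_mk, AddHom.coe_mk, sum_apply]
  refine Finset.sum_congr rfl fun i _ => ?_
  rw [ContinuousMultilinearMap.compContinuousLinearMap_apply]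
  congr 1
  ext j
  rcases eq_or_ne j i with rfl | h
  · simp
  · simp [h]

theorem hasFDerivAt_diag {k : ℕ} (M : V [×k]→L[ℝ] ℝ) (x : V) :
    HasFDerivAt (fun x => M fun _ => x)
      ((M.linearDeriv fun _ => x).comp (ContinuousLinearMap.pi fun _ => .id ℝ V)) x :=
  (M.hasFDerivAt fun _ => x).comp x
    (ContinuousLinearMap.pi fun _ => ContinuousLinearMap.id ℝ V).hasFDerivAt

theorem contDiff_diag {k : ℕ} (M : V [×k]→L[ℝ] ℝ) {n : WithTop ℕ∞} :
    ContDiff ℝ n fun x => M fun _ => x :=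
  M.contDiff.comp (contDiff_pi.2 fun _ => contDiff_id)

theorem fderiv_diag {k : ℕ} (M : V [×k]→L[ℝ] ℝ) (x v : V) :
    fderiv ℝ (fun x => M fun _ => x) x v = ∑ i, M (Function.update (fun _ => x) i v) := by
  rw [(hasFDerivAt_diag M x).fderiv, ContinuousLinearMap.comp_apply,
    ContinuousMultilinearMap.linearDeriv_apply]
  rfl

theorem fderiv_diag_apply_self {k : ℕ} (A : V →L[ℝ] V) (M : V [×k]→L[ℝ] ℝ) (x : V) :
    fderiv ℝ (fun x => M fun _ => x) x (A x) = lieDeriv A M fun _ => x := by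
  rw [fderiv_diag, lieDeriv_apply]

variable [FiniteDimensional ℝ V]

/-- The coordinates of a `k`-linear form in an orthonormal basis. -/
noncomputable def formCoord (V : Type*) [NormedAddCommGroup V] [InnerProductSpace ℝ V]
    [FiniteDimensional ℝ V] (k : ℕ) : (V [×k]→L[ℝ] ℝ) →ₗ[ℝ]
      EuclideanSpace ℝ (Fin k → Fin (Module.finrank ℝ V)) where
  toFun M := WithLp.toLp 2 fun j => M fun i => stdOrthonormalBasis ℝ V (j i)
  map_add' _ _ := rfl
  map_smul' _ _ := rfl

theorem formCoord_apply {k : ℕ} (M : V [×k]→L[ℝ] ℝ) (j : Fin k → Fin (Module.finrank ℝ V)) :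
    formCoord V k M j = M fun i => stdOrthonormalBasis ℝ V (j i) := rfl

theorem formCoord_injective (k : ℕ) : Function.Injective (formCoord V k) := by
  intro M N h
  apply ContinuousMultilinearMap.toMultilinearMap_injective
  refine Module.Basis.ext_multilinear (fun _ => (stdOrthonormalBasis ℝ V).toBasis) fun j => ?_
  simpa [formCoord_apply] using congrFun (congrArg WithLp.ofLp h) j

/-- In orthonormal coordinates the derivation acts on one index at a time through the matrix of `A`,
so its adjoint acts through the transposed matrix. -/
theorem inner_formCoord_lieDeriv {k : ℕ} (A : V →L[ℝ] V) (M N : V [×k]→L[ℝ] ℝ) :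
    inner ℝ (formCoord V k (lieDeriv A M)) (formCoord V k N) =
      inner ℝ (formCoord V k M) (formCoord V k (lieDeriv (transposeOp A) N)) := by
  have := FiniteDimensional.complete ℝ V
  set b := stdOrthonormalBasis ℝ V
  have hexp : ∀ (B : V →L[ℝ] V) (Q : V [×k]→L[ℝ] ℝ) (j : Fin k → Fin (Module.finrank ℝ V)),
      lieDeriv B Q (fun i => b (j i)) =
        ∑ i, ∑ a, inner ℝ (b a) (B (b (j i))) * Q fun l => b (Function.update j i a l) := by
    intro B Q j
    rw [lieDeriv_apply]
    refine Finset.sum_congr rfl fun i _ => ?_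
    conv_lhs => rw [← b.sum_repr' (B (b (j i)))]
    refine (Q.toMultilinearMap.map_update_sum _ _ _ _).trans ?_
    refine Finset.sum_congr rfl fun a _ => ?_
    refine (Q.map_update_smul _ _ _ _).trans ?_
    rw [smul_eq_mul]
    congr 2
    ext l
    rcases eq_or_ne l i with rfl | h
    · simp
    · simp [h]
  simp only [PiLp.inner_apply, formCoord_apply, RCLike.inner_apply,
    conj_trivial]
  simp only [b] at hexp
  simp only [hexp, Finset.sum_mul, Finset.mul_sum]
  rw [Finset.sum_comm, Finset.sum_comm (s := Finset.univ (α := Fin k → _))]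
  refine Finset.sum_congr rfl fun i _ => ?_
  rw [← Fintype.sum_prod_type', ← Fintype.sum_prod_type']
  -- Swapping the `i`-th index with the summation index `a` exchanges the two sides of the identity.
  let e : Equiv.Perm ((Fin k → Fin (Module.finrank ℝ V)) × Fin (Module.finrank ℝ V)) :=
    Function.Involutive.toPerm (fun p => (Function.update p.1 i p.2, p.1 i)) fun p => by simp
  refine Fintype.sum_equiv e _ _ fun ⟨j, a⟩ => ?_
  rw [show e (j, a) = (Function.update j i a, j i) from rfl]
  simp only [Function.update_self, Function.update_idem, Function.update_eq_self, transposeOp]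
  rw [ContinuousLinearMap.adjoint_inner_right, real_inner_comm]
  ring

/-- Every `k`-linear form is the sum of a form in the image of the derivation given by `A` and a
form in the kernel of the derivation given by `Aᵀ`. -/
theorem exists_lieDeriv_add {k : ℕ} (A : V →L[ℝ] V) (M : V [×k]→L[ℝ] ℝ) :
    ∃ f K : V [×k]→L[ℝ] ℝ, M = lieDeriv A f + K ∧ lieDeriv (transposeOp A) K = 0 := by
  obtain ⟨y, ⟨f, hf⟩, z, hz, hyz⟩ := Submodule.exists_add_mem_mem_orthogonal
    (K := LinearMap.range (formCoord V k ∘ₗ lieDeriv A)) (formCoord V k M)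
  refine ⟨f, M - lieDeriv A f, by abel, ?_⟩
  have hzK : formCoord V k (M - lieDeriv A f) = z := by
    rw [map_sub, hyz, ← hf, LinearMap.comp_apply, add_sub_cancel_left]
  apply formCoord_injective
  -- The squared norm of the image of the residual `K` under the adjoint is the pairing of `K` with
  -- an element of the range, to which it is orthogonal.
  rw [map_zero, ← inner_self_eq_zero (𝕜 := ℝ), ← inner_formCoord_lieDeriv, hzK]
  exact (Submodule.mem_orthogonal _ _).1 hz _ ⟨_, rfl⟩

/-- A form in the kernel of the derivation given by `Aᵀ` is invariant under `𝐒` on the diagonal. -/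
theorem diag_invariant_of_lieDeriv_eq_zero {k : ℕ} {A : V →L[ℝ] V} {K : V [×k]→L[ℝ] ℝ}
    (hK : lieDeriv (transposeOp A) K = 0) {s : GLV V} (hs : s ∈ groupS A) (x : V) :
    (K fun _ => (s : V →L[ℝ] V) x) = K fun _ => x := by
  have := FiniteDimensional.complete ℝ V
  -- Invariance is a closed condition on `s`, so it suffices to treat `e^{t Aᵀ}`; along this group
  -- the value of `K` has derivative zero.
  have hcl : IsClosed {s : GLV V | (K fun _ => (s : V →L[ℝ] V) x) = K fun _ => x} := by
    refine isClosed_eq ?_ continuous_const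
    have h : Continuous fun s : GLV V => (s : V →L[ℝ] V) x :=
      (ContinuousLinearMap.apply ℝ V x).continuous.comp Units.continuous_val
    exact (continuous_diag K).comp h
  refine closure_minimal ?_ hcl hs
  rintro _ ⟨t, rfl⟩
  have hder : ∀ t : ℝ, HasDerivAt
      (fun t : ℝ => K fun _ => NormedSpace.exp (t • transposeOp A) x) 0 t := by
    intro t
    have h1 := (ContinuousLinearMap.apply ℝ V x).hasFDerivAt.comp_hasDerivAt t
      (hasDerivAt_exp_smul_const' (transposeOp A) t)
    have h2 := ((hasFDerivAt_diag K _).differentiableAt.hasFDerivAt).comp_hasDerivAt t h1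
    refine h2.congr_deriv ((fderiv_diag_apply_self (transposeOp A) K _).trans ?_)
    rw [hK, zero_apply]
  have hconst := is_const_of_deriv_eq_zero (fun t => (hder t).differentiableAt)
    (fun t => (hder t).deriv) (Multiplicative.toAdd t) 0
  simpa [coe_expHom] using hconst

end LieDeriv

/-! ### Averaging the homological equation over the compact group -/

section Averaging

variable {V : Type*} [NormedAddCommGroup V] [InnerProductSpace ℝ V]

theorem units_sign_mul_self (u : ℤˣ) : ((u : ℤ) : ℝ) * ((u : ℤ) : ℝ) = 1 := by
  norm_cast
  exact Int.units_coe_mul_self u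

theorem sign_mul (u v : ℤˣ) : (((u * v : ℤˣ) : ℤ) : ℝ) = ((u : ℤ) : ℝ) * ((v : ℤ) : ℝ) := by
  push_cast
  rfl

theorem sign_inv {G : Type*} [Group G] (σ : G →* ℤˣ) (g : G) :
    (((σ g⁻¹ : ℤˣ) : ℤ) : ℝ) = ((σ g : ℤˣ) : ℤ) := by
  rw [map_inv, Int.units_inv_eq_self]

variable {Γ : Type*} [Group Γ]

theorem rep_inv_rep (ρ : Γ →* GLV V) (γ : Γ) (x : V) :
    (ρ γ⁻¹ : V →L[ℝ] V) ((ρ γ : V →L[ℝ] V) x) = x := by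
  rw [map_inv]
  exact congrArg (fun T : V →L[ℝ] V => T x) (Units.inv_mul (ρ γ))

theorem rep_rep_inv (ρ : Γ →* GLV V) (γ : Γ) (x : V) :
    (ρ γ : V →L[ℝ] V) ((ρ γ⁻¹ : V →L[ℝ] V) x) = x := by
  simpa using rep_inv_rep ρ γ⁻¹ x

theorem rep_mul (ρ : Γ →* GLV V) (γ δ : Γ) (x : V) :
    (ρ (γ * δ) : V →L[ℝ] V) x = (ρ γ : V →L[ℝ] V) ((ρ δ : V →L[ℝ] V) x) := by
  rw [map_mul]
  rfl

/-- The chain rule for a function that is multiplied by `c` under the linear operator `g`. -/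
theorem fderiv_map_of_eventuallyEq {F : V → ℝ} (g : V →L[ℝ] V) (c : ℝ) {x : V}
    (hF : DifferentiableAt ℝ F (g x)) (hF' : DifferentiableAt ℝ F x)
    (h : (fun y => F (g y)) =ᶠ[𝓝 x] fun y => c * F y) (v : V) :
    fderiv ℝ F (g x) (g v) = c * fderiv ℝ F x v := by
  have h1 : HasFDerivAt (fun y => F (g y)) ((fderiv ℝ F (g x)).comp g) x :=
    hF.hasFDerivAt.comp x g.hasFDerivAt
  have h2 : HasFDerivAt (fun y => c * F y) (c • fderiv ℝ F x) x := hF'.hasFDerivAt.const_mul c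
  exact congrArg (fun T : V →L[ℝ] ℝ => T v) (h1.unique (h2.congr_of_eventuallyEq h))

variable [FiniteDimensional ℝ V] [TopologicalSpace Γ] [IsTopologicalGroup Γ] [CompactSpace Γ]

/-- The homological equation with symmetry: a `σ₁ σ₂`-semiinvariant homogeneous polynomial is the
sum of the derivative of a `σ₁`-semiinvariant one along `L` and an `𝐒`-invariant one. -/
theorem exists_homological (ρ : Γ →* GLV V) (hρ : Continuous ρ) (σ₁ σ₂ : Γ →* ℤˣ)
    (hσ₁ : Continuous fun γ => (((σ₁ γ : ℤˣ) : ℤ) : ℝ)) {L : V →L[ℝ] V}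
    (hL : ∀ γ x, L ((ρ γ : V →L[ℝ] V) x) =
      (((σ₂ γ : ℤˣ) : ℤ) : ℝ) • (ρ γ : V →L[ℝ] V) (L x))
    (hS : ∀ γ, ρ γ ∈ Subgroup.normalizer (groupS L : Set (GLV V)))
    {k : ℕ} (P : V [×k]→L[ℝ] ℝ)
    (hP : ∀ γ x, (P fun _ => (ρ γ : V →L[ℝ] V) x) =
      (((σ₁ γ : ℤˣ) : ℤ) : ℝ) * (((σ₂ γ : ℤˣ) : ℤ) : ℝ) * P fun _ => x) :
    ∃ f K : V [×k]→L[ℝ] ℝ,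
      (∀ x, (P fun _ => x) = fderiv ℝ (fun x => f fun _ => x) x (L x) + K fun _ => x) ∧
      (∀ γ x, (f fun _ => (ρ γ : V →L[ℝ] V) x) = (((σ₁ γ : ℤˣ) : ℤ) : ℝ) * f fun _ => x) ∧
      (∀ γ x, (K fun _ => (ρ γ : V →L[ℝ] V) x) =
        (((σ₁ γ : ℤˣ) : ℤ) : ℝ) * (((σ₂ γ : ℤˣ) : ℤ) : ℝ) * K fun _ => x) ∧
      ∀ s ∈ groupS L, ∀ x, (K fun _ => (s : V →L[ℝ] V) x) = K fun _ => x := by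
  obtain ⟨g, Q, hPgQ, hQ⟩ := exists_lieDeriv_add L P
  have hQS := fun {s} hs x => diag_invariant_of_lieDeriv_eq_zero hQ (s := s) hs x
  let _ : MeasurableSpace Γ := borel Γ
  have _ : BorelSpace Γ := ⟨rfl⟩
  let μ : Measure Γ := Measure.haarMeasure ⊤
  have hμ : μ Set.univ = 1 := Measure.haarMeasure_self
  have _ : IsProbabilityMeasure μ := ⟨hμ⟩
  -- The twist by `σ₁` makes the Haar average of `φ` multiply by `σ₁` under `Γ`, by left invariance.
  let φ : Γ → V [×k]→L[ℝ] ℝ := fun γ => (((σ₁ γ : ℤˣ) : ℤ) : ℝ) •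
    g.compContinuousLinearMap fun _ => (ρ γ⁻¹ : V →L[ℝ] V)
  have hφc : Continuous φ := by
    refine hσ₁.smul ?_
    have h1 : Continuous fun γ => (ρ γ⁻¹ : V →L[ℝ] V) :=
      Units.continuous_val.comp (hρ.comp continuous_inv)
    have h2 := (ContinuousMultilinearMap.compContinuousLinearMapContinuousMultilinear ℝ
      (fun _ : Fin k => V) (fun _ => V) ℝ).cont.comp (continuous_pi fun _ => h1)
    exact (ContinuousLinearMap.apply ℝ (V [×k]→L[ℝ] ℝ) g).continuous.comp h2
  have hφi : Integrable φ μ :=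
    hφc.integrable_of_hasCompactSupport (HasCompactSupport.of_compactSpace φ)
  have hcoe : ∀ v : Fin k → V, (∫ γ, φ γ ∂μ) v = ∫ γ, φ γ v ∂μ := fun v =>
    ((ContinuousMultilinearMap.apply ℝ (fun _ : Fin k => V) ℝ v).integral_comp_comm hφi).symm
  have hvi : ∀ v : Fin k → V, Integrable (fun γ => φ γ v) μ := fun v =>
    (ContinuousMultilinearMap.apply ℝ (fun _ : Fin k => V) ℝ v).integrable_comp hφi
  set f := ∫ γ, φ γ ∂μ with hf
  have hfeq : ∀ γ x, (f fun _ => (ρ γ : V →L[ℝ] V) x) =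
      (((σ₁ γ : ℤˣ) : ℤ) : ℝ) * f fun _ => x := by
    intro δ x
    rw [hcoe, hcoe, ← integral_const_mul,
      ← integral_mul_left_eq_self (fun γ => φ γ fun _ => (ρ δ : V →L[ℝ] V) x) δ]
    congr 1
    ext γ
    simp only [φ, smul_apply, ContinuousMultilinearMap.compContinuousLinearMap_apply, smul_eq_mul]
    rw [mul_inv_rev, map_mul σ₁, sign_mul, mul_assoc]
    congr 3
    ext i
    rw [rep_mul, rep_inv_rep]
  have hdf : ∀ γ x, fderiv ℝ (fun x => f fun _ => x) ((ρ γ : V →L[ℝ] V) x)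
      (L ((ρ γ : V →L[ℝ] V) x)) = (((σ₁ γ : ℤˣ) : ℤ) : ℝ) * (((σ₂ γ : ℤˣ) : ℤ) : ℝ) *
        fderiv ℝ (fun x => f fun _ => x) x (L x) := by
    intro γ x
    rw [hL, map_smul, fderiv_map_of_eventuallyEq _ _ (hasFDerivAt_diag f _).differentiableAt
      (hasFDerivAt_diag f _).differentiableAt (.of_forall (hfeq γ)), smul_eq_mul]
    ring
  -- Since `L` commutes with `γ` up to `σ₂(γ)`, replacing `g` by its average `f` replaces the
  -- remainder `Q` by its own average, twisted by `σ₁ σ₂`.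
  have hK : ∀ x, (P fun _ => x) - lieDeriv L f (fun _ => x) =
      ∫ γ, (((σ₁ γ : ℤˣ) : ℤ) : ℝ) * (((σ₂ γ : ℤˣ) : ℤ) : ℝ) *
        Q fun _ => (ρ γ⁻¹ : V →L[ℝ] V) x ∂μ := by
    intro x
    have h1 : lieDeriv L f (fun _ => x) = ∫ γ, lieDeriv L (φ γ) (fun _ => x) ∂μ := by
      simp only [lieDeriv_apply, hcoe]
      rw [integral_finsetSum]
      exact fun i _ => hvi _
    have h2 : (P fun _ => x) = ∫ _ : Γ, (P fun _ => x) ∂μ := by simp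
    rw [h1, h2, ← integral_sub (integrable_const _)]
    · congr 1
      ext γ
      have h3 : (P fun _ => x) = (((σ₁ γ : ℤˣ) : ℤ) : ℝ) * (((σ₂ γ : ℤˣ) : ℤ) : ℝ) *
          P fun _ => (ρ γ⁻¹ : V →L[ℝ] V) x := by
        rw [← hP, rep_rep_inv]
      rw [h3, hPgQ]
      simp only [add_apply, lieDeriv_apply, φ, smul_apply, smul_eq_mul,
        ContinuousMultilinearMap.compContinuousLinearMap_apply]
      rw [mul_add, add_sub_right_comm, add_eq_right, sub_eq_zero, Finset.mul_sum]
      refine Finset.sum_congr rfl fun i _ => ?_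
      have h4 : (fun j => (ρ γ⁻¹ : V →L[ℝ] V) (Function.update (fun _ => x) i (L x) j)) =
          Function.update (fun _ => (ρ γ⁻¹ : V →L[ℝ] V) x) i
            ((((σ₂ γ : ℤˣ) : ℤ) : ℝ) • L ((ρ γ⁻¹ : V →L[ℝ] V) x)) := by
        ext j
        rcases eq_or_ne j i with rfl | h
        · rw [Function.update_self, Function.update_self, hL, sign_inv, smul_smul, units_sign_mul_self,
            one_smul]
        · simp [h]
      rw [h4, ContinuousMultilinearMap.map_update_smul, smul_eq_mul, mul_assoc]
    · simp only [lieDeriv_apply]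
      exact integrable_finsetSum _ fun i _ => hvi _
  refine ⟨f, P - lieDeriv L f, fun x => ?_, hfeq, fun γ x => ?_, fun s hs x => ?_⟩
  · rw [fderiv_diag_apply_self, sub_apply]
    ring
  · rw [sub_apply, sub_apply, hP, ← fderiv_diag_apply_self, hdf, fderiv_diag_apply_self]
    ring
  · rw [sub_apply, sub_apply, hK, hK]
    congr 1
    ext γ
    -- Moving `s` past `γ⁻¹` conjugates it inside `𝐒`, so every integrand is unchanged.
    have hs' : ρ γ⁻¹ * s * (ρ γ⁻¹)⁻¹ ∈ groupS L :=
      (Subgroup.mem_normalizer_iff.1 (hS γ⁻¹) s).1 hs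
    have := hQS hs' ((ρ γ⁻¹ : V →L[ℝ] V) x)
    rw [← this]
    congr 2
    ext i
    rw [← map_inv, inv_inv]
    simp only [Units.val_mul]
    change _ = (ρ γ⁻¹ : V →L[ℝ] V) ((s : V →L[ℝ] V)
      ((ρ γ : V →L[ℝ] V) ((ρ γ⁻¹ : V →L[ℝ] V) x)))
    rw [rep_rep_inv]

end Averaging

/-! ### Difference estimates and vanishing of homogeneous terms -/

section Estimates

theorem isBigO_norm_of_sub {V : Type*} [NormedAddCommGroup V] {Z : V → V} (hZ : (fun x => Z x - x) =O[𝓝 0] fun x => ‖x‖ ^ 2) :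
    Z =O[𝓝 0] fun x => ‖x‖ := by
  have h1 : (fun x => Z x - x) =O[𝓝 0] fun x => ‖x‖ := by
    simpa using hZ.trans (isBigO_norm_pow_of_le (show 1 ≤ 2 by simp))
  simpa using h1.add (isBigO_refl (fun x : V => x) (𝓝 0)).norm_right

variable {V : Type*} [NormedAddCommGroup V] [NormedSpace ℝ V]

/-- A mean value estimate for the difference of the values of `Φ` at two points near `x`, when the
derivative of `Φ` is `Λ` up to order `p`. -/
theorem sub_sub_isBigO {Φ : V → ℝ} {Λ : V →L[ℝ] V →L[ℝ] ℝ} {p m : ℕ} {Z₁ Z₂ : V → V}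
    (hΦ : ∀ᶠ z in 𝓝 0, DifferentiableAt ℝ Φ z)
    (hd : (fun z => fderiv ℝ Φ z - Λ z) =O[𝓝 0] fun z => ‖z‖ ^ p)
    (h₁ : Z₁ =O[𝓝 0] fun x => ‖x‖) (h₂ : Z₂ =O[𝓝 0] fun x => ‖x‖)
    (hΛ₁ : (fun x => Λ (Z₁ x) - Λ x) =O[𝓝 0] fun x => ‖x‖ ^ p)
    (hΛ₂ : (fun x => Λ (Z₂ x) - Λ x) =O[𝓝 0] fun x => ‖x‖ ^ p)
    (h : (fun x => Z₁ x - Z₂ x) =O[𝓝 0] fun x => ‖x‖ ^ m) :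
    (fun x => Φ (Z₁ x) - Φ (Z₂ x) - Λ x (Z₁ x - Z₂ x)) =O[𝓝 0] fun x => ‖x‖ ^ (p + m) := by
  obtain ⟨D, hD0, hD⟩ := hd.exists_nonneg
  obtain ⟨c₁, hc₁0, hc₁⟩ := h₁.exists_nonneg
  obtain ⟨c₂, hc₂0, hc₂⟩ := h₂.exists_nonneg
  obtain ⟨b₁, hb₁0, hb₁⟩ := hΛ₁.exists_nonneg
  obtain ⟨b₂, hb₂0, hb₂⟩ := hΛ₂.exists_nonneg
  obtain ⟨e, he0, he⟩ := h.exists_nonneg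
  set c := max c₁ c₂
  set b := max b₁ b₂
  obtain ⟨ε, hε, hball⟩ := Metric.eventually_nhds_iff_ball.1 (hΦ.and hD.bound)
  have hsmall : ∀ᶠ x : V in 𝓝 0, c * ‖x‖ < ε := by
    have : Tendsto (fun x : V => c * ‖x‖) (𝓝 0) (𝓝 (c * ‖(0 : V)‖)) :=
      (continuous_const.mul continuous_norm).tendsto _
    rw [norm_zero, mul_zero] at this
    exact this.eventually_lt_const hε
  refine .of_bound ((D * c ^ p + b) * e) ?_
  filter_upwards [hsmall, hc₁.bound, hc₂.bound, hb₁.bound, hb₂.bound, he.bound]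
    with x hx hx₁ hx₂ hy₁ hy₂ hz
  simp only [norm_pow, norm_norm] at hx₁ hx₂ hy₁ hy₂ hz
  -- A convex set containing both points on which `dΦ` differs from the constant `Λ x` by `O(‖x‖ ^
  -- p)`, so the mean value inequality applies.
  let s : Set V := Metric.closedBall 0 (c * ‖x‖) ∩ Λ ⁻¹' Metric.closedBall (Λ x) (b * ‖x‖ ^ p)
  have hs : Convex ℝ s := (convex_closedBall _ _).inter
    ((convex_closedBall _ _).linear_preimage (Λ : V →ₗ[ℝ] V →L[ℝ] ℝ))
  have hs₁ : Z₁ x ∈ s := by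
    refine ⟨mem_closedBall_zero_iff.2 (hx₁.trans ?_), ?_⟩
    · gcongr
      exact le_max_left _ _
    · rw [Set.mem_preimage, mem_closedBall_iff_norm]
      refine hy₁.trans ?_
      gcongr
      exact le_max_left _ _
  have hs₂ : Z₂ x ∈ s := by
    refine ⟨mem_closedBall_zero_iff.2 (hx₂.trans ?_), ?_⟩
    · gcongr
      exact le_max_right _ _
    · rw [Set.mem_preimage, mem_closedBall_iff_norm]
      refine hy₂.trans ?_
      gcongr
      exact le_max_right _ _
  have hb0 : ∀ z ∈ s, z ∈ Metric.ball (0 : V) ε := fun z hz => by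
    rw [mem_ball_zero_iff]
    exact (mem_closedBall_zero_iff.1 hz.1).trans_lt hx
  have key := hs.norm_image_sub_le_of_norm_fderiv_le' (f := Φ) (φ := Λ x)
    (C := (D * c ^ p + b) * ‖x‖ ^ p) (fun z hz => (hball z (hb0 z hz)).1) (fun z hz => by
      have h1 := (hball z (hb0 z hz)).2
      have h2 : ‖Λ z - Λ x‖ ≤ b * ‖x‖ ^ p := mem_closedBall_iff_norm.1 hz.2
      rw [norm_pow, norm_norm] at h1
      calc ‖fderiv ℝ Φ z - Λ x‖ ≤ ‖fderiv ℝ Φ z - Λ z‖ + ‖Λ z - Λ x‖ :=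
          norm_sub_le_norm_sub_add_norm_sub _ _ _
        _ ≤ D * (c * ‖x‖) ^ p + b * ‖x‖ ^ p := by
          gcongr
          refine h1.trans ?_
          gcongr
          exact mem_closedBall_zero_iff.1 hz.1
        _ = _ := by ring) hs₂ hs₁
  refine key.trans ?_
  rw [norm_pow, norm_norm, pow_add]
  calc _ ≤ (D * c ^ p + b) * ‖x‖ ^ p * (e * ‖x‖ ^ m) := by gcongr
    _ = _ := by ring

/-- A homogeneous polynomial of degree `n` that is `O(‖x‖ ^ (n + 1))` is zero. -/
theorem diag_eq_zero_of_isBigO {n : ℕ} {M : V [×n]→L[ℝ] ℝ}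
    (h : (fun x => M fun _ => x) =O[𝓝 0] fun x => ‖x‖ ^ (n + 1)) (x : V) :
    (M fun _ => x) = 0 := by
  have htend : Tendsto (fun t : ℝ => t • x) (𝓝[>] 0) (𝓝 0) := by
    have : Tendsto (fun t : ℝ => t • x) (𝓝 0) (𝓝 ((0 : ℝ) • x)) :=
      (continuous_id.smul continuous_const).tendsto _
    rw [zero_smul] at this
    exact this.mono_left nhdsWithin_le_nhds
  have := coeff_eq_zero_of_isBigO (n := n + 1) (a := fun k => if k = n then M fun _ => x else 0)
    (((h.comp_tendsto htend).congr_left fun t => ?_).trans ?_) n n.lt_succ_self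
  · simpa using this
  · simp [map_diag_smul]
  · refine .of_bound (‖x‖ ^ (n + 1)) (.of_forall fun t => ?_)
    simp [norm_smul, mul_pow, mul_comm]

end Estimates

/-! ### Hamiltonian vector fields and their symmetry -/

section HamiltonianVF

variable {V : Type*} [NormedAddCommGroup V] [InnerProductSpace ℝ V] [FiniteDimensional ℝ V]
variable (ω : LinearMap.BilinForm ℝ V) (hω : ω.Nondegenerate)

/-- The inverse of the isomorphism `V → V*` given by `ω`, as a continuous linear map. -/
noncomputable def ofDualCLM : (V →L[ℝ] ℝ) →L[ℝ] V :=
  LinearMap.toContinuousLinearMap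
    ((ω.toDual hω).symm.toLinearMap ∘ₗ (LinearMap.toContinuousLinearMap (E := V)).symm.toLinearMap)

theorem hamiltonianVF_eq (H : V → ℝ) :
    hamiltonianVF ω hω H = fun x => ofDualCLM ω hω (fderiv ℝ H x) := rfl

variable {ω}

theorem eq_of_apply_eq (hω : ω.Nondegenerate) {u v : V} (h : ∀ w, ω u w = ω v w) : u = v :=
  (ω.toDual hω).injective (LinearMap.ext h)

theorem hamiltonianVF_eq_of_apply {H : V → ℝ} {x u : V} (h : ∀ v, ω u v = fderiv ℝ H x v) :
    hamiltonianVF ω hω H x = u :=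
  eq_of_apply_eq hω fun v => by rw [apply_hamiltonianVF, h]

theorem hamiltonianVF_isBigO {H : V → ℝ} (hH : ContDiffAt ℝ (⊤ : ℕ∞) H 0) {n : ℕ}
    (h : H =O[𝓝 0] fun x => ‖x‖ ^ (n + 1)) :
    hamiltonianVF ω hω H =O[𝓝 0] fun x => ‖x‖ ^ n :=
  ((ofDualCLM ω hω).isBigO_comp _ _).trans (fderiv_isBigO hH h)

theorem contDiff_hamiltonianVF {H : V → ℝ} (hH : ContDiff ℝ (⊤ : ℕ∞) H) :
    ContDiff ℝ (⊤ : ℕ∞) (hamiltonianVF ω hω H) :=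
  (ofDualCLM ω hω).contDiff.comp (hH.fderiv_right (by norm_cast))

theorem hamiltonianVF_add {H K : V → ℝ} {x : V} (hH : DifferentiableAt ℝ H x)
    (hK : DifferentiableAt ℝ K x) :
    hamiltonianVF ω hω (fun y => H y + K y) x = hamiltonianVF ω hω H x + hamiltonianVF ω hω K x := by
  simp only [hamiltonianVF_eq]
  rw [fderiv_fun_add hH hK, map_add]

/-- Tested against vectors `g v`; `s² = 1` makes `s` its own inverse. The factor `c = s` gives
equivariance (generating functions), and `c = σ₁ σ₂` with `s = σ₁` gives `σ₂`-equivariance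
(Hamiltonians). -/
theorem hamiltonianVF_map {g : GLV V} {s c : ℝ} (hs : s * s = 1)
    (hg : ∀ u v, ω ((g : V →L[ℝ] V) u) ((g : V →L[ℝ] V) v) = s * ω u v) {F : V → ℝ} {x : V}
    (hF : DifferentiableAt ℝ F ((g : V →L[ℝ] V) x)) (hF' : DifferentiableAt ℝ F x)
    (h : (fun y => F ((g : V →L[ℝ] V) y)) =ᶠ[𝓝 x] fun y => c * F y) :
    hamiltonianVF ω hω F ((g : V →L[ℝ] V) x) =
      (s * c) • (g : V →L[ℝ] V) (hamiltonianVF ω hω F x) := by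
  refine hamiltonianVF_eq_of_apply hω fun w => ?_
  obtain ⟨v, rfl⟩ : ∃ v, (g : V →L[ℝ] V) v = w :=
    ⟨((g⁻¹ : GLV V) : V →L[ℝ] V) w, congrArg (fun T : V →L[ℝ] V => T w) (Units.mul_inv g)⟩
  rw [fderiv_map_of_eventuallyEq _ c hF hF' h, map_smul, LinearMap.smul_apply, hg,
    apply_hamiltonianVF, smul_eq_mul]
  linear_combination c * fderiv ℝ F x v * hs

end HamiltonianVF

/-! ### The generating function, degree by degree -/

section NormalForm

variable {V : Type*} [NormedAddCommGroup V] [InnerProductSpace ℝ V]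

theorem IsHomogeneousPoly.contDiff {k : ℕ} {F : V → ℝ} (hF : IsHomogeneousPoly k F)
    {n : WithTop ℕ∞} : ContDiff ℝ n F := by
  obtain ⟨M, hM⟩ := hF
  rw [funext hM]
  exact contDiff_diag M

theorem IsHomogeneousPoly.isBigO {k : ℕ} {F : V → ℝ} (hF : IsHomogeneousPoly k F) :
    F =O[𝓝 0] fun x => ‖x‖ ^ k := by
  obtain ⟨M, hM⟩ := hF
  rw [funext hM]
  exact isBigO_diag M _

/-- The Hamiltonian `ω(L x, x) / 2 + K³(x) + ⋯ + Kʳ(x)` of the truncated vector field. -/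
noncomputable def truncatedHam (ω : LinearMap.BilinForm ℝ V) (L : V →L[ℝ] V) (K : ℕ → V → ℝ)
    (r : ℕ) (x : V) : ℝ :=
  1 / 2 * ω (L x) x + ∑ k ∈ Finset.Icc 3 r, K k x

variable {ω : LinearMap.BilinForm ℝ V} {L : V →L[ℝ] V} {K : ℕ → V → ℝ} {r : ℕ}

theorem truncatedHam_map {g : GLV V} {s c : ℝ}
    (hg : ∀ u v, ω ((g : V →L[ℝ] V) u) ((g : V →L[ℝ] V) v) = s * ω u v)
    (hLg : ∀ x, L ((g : V →L[ℝ] V) x) = c • (g : V →L[ℝ] V) (L x))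
    (hK : ∀ k ∈ Finset.Icc 3 r, ∀ x, K k ((g : V →L[ℝ] V) x) = s * c * K k x) (x : V) :
    truncatedHam ω L K r ((g : V →L[ℝ] V) x) = s * c * truncatedHam ω L K r x := by
  rw [truncatedHam, truncatedHam, mul_add, Finset.mul_sum, hLg, map_smul, LinearMap.smul_apply, hg,
    smul_eq_mul, Finset.sum_congr rfl fun k hk => hK k hk x]
  ring

variable [FiniteDimensional ℝ V]

/-- The operator `x ↦ ω(L x, ·)`. -/
noncomputable def quadraticDual (ω : LinearMap.BilinForm ℝ V) (L : V →L[ℝ] V) :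
    V →L[ℝ] V →L[ℝ] ℝ :=
  ω.toContinuousBilinearMap.comp L

theorem quadraticDual_apply (ω : LinearMap.BilinForm ℝ V) (L : V →L[ℝ] V) (x v : V) :
    quadraticDual ω L x v = ω (L x) v := rfl

theorem hasFDerivAt_quadratic (hL : ∀ u v, ω (L u) v = ω (L v) u) (x : V) :
    HasFDerivAt (fun x => 1 / 2 * ω (L x) x) (quadraticDual ω L x) x := by
  have h := (((quadraticDual ω L).hasFDerivAt (x := x)).clm_apply (hasFDerivAt_id x)).const_mul
    (1 / 2)
  refine h.congr_fderiv ?_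
  ext v
  simp only [smul_apply, add_apply, ContinuousLinearMap.comp_apply, ContinuousLinearMap.flip_apply,
    quadraticDual_apply, id, ContinuousLinearMap.id_apply, smul_eq_mul]
  rw [hL v x]
  ring

theorem contDiff_truncatedHam (hK : ∀ k ∈ Finset.Icc 3 r, IsHomogeneousPoly k (K k))
    {n : WithTop ℕ∞} : ContDiff ℝ n (truncatedHam ω L K r) := by
  have h : ContDiff ℝ n fun x => quadraticDual ω L x x :=
    (quadraticDual ω L).contDiff.clm_apply contDiff_id
  exact (contDiff_const.mul h).add (ContDiff.sum fun k hk => (hK k hk).contDiff)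

theorem fderiv_truncatedHam (hL : ∀ u v, ω (L u) v = ω (L v) u)
    (hK : ∀ k ∈ Finset.Icc 3 r, IsHomogeneousPoly k (K k)) (x : V) :
    fderiv ℝ (truncatedHam ω L K r) x =
      quadraticDual ω L x + ∑ k ∈ Finset.Icc 3 r, fderiv ℝ (K k) x := by
  refine ((hasFDerivAt_quadratic hL x).add (HasFDerivAt.fun_sum fun k hk => ?_)).fderiv
  exact ((hK k hk).contDiff.differentiable one_ne_zero x).hasFDerivAt

theorem fderiv_truncatedHam_isBigO (hL : ∀ u v, ω (L u) v = ω (L v) u)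
    (hK : ∀ k ∈ Finset.Icc 3 r, IsHomogeneousPoly k (K k)) :
    (fun x => fderiv ℝ (truncatedHam ω L K r) x - quadraticDual ω L x) =O[𝓝 0]
      fun x => ‖x‖ ^ 2 := by
  simp only [fderiv_truncatedHam hL hK, add_sub_cancel_left]
  refine IsBigO.fun_sum fun k hk => ?_
  have h3 := (Finset.mem_Icc.1 hk).1
  exact fderiv_isBigO (hK k hk).contDiff.contDiffAt
    ((hK k hk).isBigO.trans (isBigO_norm_pow_of_le h3))

theorem hamiltonianVF_truncatedHam (hω : ω.Nondegenerate) (hL : ∀ u v, ω (L u) v = ω (L v) u)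
    (hK : ∀ k ∈ Finset.Icc 3 r, IsHomogeneousPoly k (K k)) (x : V) :
    hamiltonianVF ω hω (truncatedHam ω L K r) x = truncatedVF ω hω L K r x := by
  refine hamiltonianVF_eq_of_apply hω fun v => ?_
  rw [fderiv_truncatedHam hL hK, truncatedVF]
  simp only [map_add, map_sum, LinearMap.add_apply, LinearMap.sum_apply, add_apply, sum_apply,
    quadraticDual_apply, apply_hamiltonianVF]

/-- The shifted identity `x ↦ x + c X_F(x)`. -/
noncomputable def shift (ω : LinearMap.BilinForm ℝ V) (hω : ω.Nondegenerate) (F : V → ℝ) (c : ℝ)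
    (x : V) : V :=
  x + c • hamiltonianVF ω hω F x

variable (hω : ω.Nondegenerate)

theorem contDiff_shift {F : V → ℝ} (hF : ContDiff ℝ (⊤ : ℕ∞) F) (c : ℝ) :
    ContDiff ℝ (⊤ : ℕ∞) (shift ω hω F c) :=
  contDiff_id.add (contDiff_const.smul (contDiff_hamiltonianVF hω hF))

theorem shift_sub_isBigO {F : V → ℝ} (hF : ContDiff ℝ (⊤ : ℕ∞) F)
    (hF3 : F =O[𝓝 0] fun x => ‖x‖ ^ 3) (c : ℝ) :
    (fun x => shift ω hω F c x - x) =O[𝓝 0] fun x => ‖x‖ ^ 2 := by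
  simp only [shift, add_sub_cancel_left]
  exact (hamiltonianVF_isBigO hω hF.contDiffAt hF3).const_smul_left c

theorem shift_add {F f : V → ℝ} (hF : ContDiff ℝ (⊤ : ℕ∞) F) (hf : ContDiff ℝ (⊤ : ℕ∞) f) (c : ℝ)
    (x : V) : shift ω hω (fun y => F y + f y) c x =
      shift ω hω F c x + c • hamiltonianVF ω hω f x := by
  rw [shift, hamiltonianVF_add hω (hF.differentiable (by simp) x)
    (hf.differentiable (by simp) x), smul_add, ← add_assoc, shift]

theorem shift_map {g : GLV V} {s : ℝ} (hs : s * s = 1)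
    (hg : ∀ u v, ω ((g : V →L[ℝ] V) u) ((g : V →L[ℝ] V) v) = s * ω u v) {F : V → ℝ}
    (hF : ContDiff ℝ (⊤ : ℕ∞) F) (h : ∀ x, F ((g : V →L[ℝ] V) x) = s * F x) (c : ℝ) (x : V) :
    shift ω hω F c ((g : V →L[ℝ] V) x) = (g : V →L[ℝ] V) (shift ω hω F c x) := by
  rw [shift, shift, map_add, map_smul, hamiltonianVF_map hω hs hg
    (hF.differentiable (by simp) _) (hF.differentiable (by simp) _) (.of_forall h), hs, one_smul]

variable {Γ : Type*} [Group Γ] [TopologicalSpace Γ] [IsTopologicalGroup Γ] [CompactSpace Γ]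

/-- The inductive construction of the normal form: a generating function `F` whose midpoint
transformation brings `H` into normal form up to order `r`. -/
theorem exists_generatingFunction (hωs : ∀ u v, ω u v = -ω v u)
    (ρ : Γ →* GLV V) (hρ : Continuous ρ) (σ₁ σ₂ : Γ →* ℤˣ)
    (hσ₁ : Continuous fun γ => (((σ₁ γ : ℤˣ) : ℤ) : ℝ)) (hρω : IsSemisymplectic ω ρ σ₁)
    {H : V → ℝ} (hH : ContDiff ℝ (⊤ : ℕ∞) H) (hH0 : H 0 = 0)
    (hHeq : ∀ γ x, H ((ρ γ : V →L[ℝ] V) x) =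
      (((σ₁ γ : ℤˣ) : ℤ) : ℝ) * (((σ₂ γ : ℤˣ) : ℤ) : ℝ) * H x)
    (hHL : (fun x => fderiv ℝ H x - quadraticDual ω L x) =O[𝓝 0] fun x => ‖x‖ ^ 2)
    (hLs : ∀ u v, ω (L u) v = ω (L v) u)
    (hL : ∀ γ x, L ((ρ γ : V →L[ℝ] V) x) =
      (((σ₂ γ : ℤˣ) : ℤ) : ℝ) • (ρ γ : V →L[ℝ] V) (L x))
    (hS : ∀ γ, ρ γ ∈ Subgroup.normalizer (groupS L : Set (GLV V))) (hr : 2 ≤ r) :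
    ∃ (F : V → ℝ) (K : ℕ → V → ℝ), ContDiff ℝ (⊤ : ℕ∞) F ∧
      (F =O[𝓝 0] fun x => ‖x‖ ^ 3) ∧
      (∀ γ x, F ((ρ γ : V →L[ℝ] V) x) = (((σ₁ γ : ℤˣ) : ℤ) : ℝ) * F x) ∧
      (∀ k ∈ Finset.Icc 3 r, IsHomogeneousPoly k (K k)) ∧
      (∀ k ∈ Finset.Icc 3 r, ∀ γ x, K k ((ρ γ : V →L[ℝ] V) x) =
        (((σ₁ γ : ℤˣ) : ℤ) : ℝ) * (((σ₂ γ : ℤˣ) : ℤ) : ℝ) * K k x) ∧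
      (∀ k ∈ Finset.Icc 3 r, ∀ s ∈ groupS L, ∀ x, K k ((s : V →L[ℝ] V) x) = K k x) ∧
      (fun x => H (shift ω hω F (1 / 2) x) - truncatedHam ω L K r (shift ω hω F (-(1 / 2)) x))
        =O[𝓝 0] fun x => ‖x‖ ^ (r + 1) := by
  induction r, hr using Nat.le_induction with
  | base =>
    -- For `r = 2` nothing is to be removed: `H` agrees with its quadratic part to third order, by
    -- the mean value estimate between `x` and `0`.
    refine ⟨0, 0, contDiff_const, isBigO_zero _ _, by simp, by simp, by simp, by simp, ?_⟩
    have hX : ∀ c x, shift ω hω 0 c x = x := fun c x => by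
      rw [shift, hamiltonianVF_eq_of_apply hω (u := 0) (by simp), smul_zero, add_zero]
    simp only [hX, truncatedHam]
    have hd : (fun z => fderiv ℝ (fun x => H x - 1 / 2 * ω (L x) x) z -
        (0 : V →L[ℝ] V →L[ℝ] ℝ) z) =O[𝓝 0] fun z => ‖z‖ ^ 2 := by
      refine hHL.congr_left fun x => ?_
      rw [fderiv_fun_sub (hH.differentiable (by simp) x)
        (hasFDerivAt_quadratic hLs x).differentiableAt, (hasFDerivAt_quadratic hLs x).fderiv]
      simp
    have := sub_sub_isBigO (Z₁ := id) (Z₂ := 0) (m := 1)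
      (.of_forall fun z => (hH.differentiable (by simp) z).sub
        (hasFDerivAt_quadratic hLs z).differentiableAt) hd
      (isBigO_refl _ _).norm_right (isBigO_zero _ _) (by simpa using isBigO_zero _ _)
      (by simpa using isBigO_zero _ _)
      (by simpa using (isBigO_refl (fun x : V => x) (𝓝 0)).norm_right)
    simpa [hH0] using this
  | succ r hr ih =>
    obtain ⟨F, K, hF, hF3, hFeq, hK, hKeq, hKS, hR⟩ := ih
    have hN : ContDiff ℝ (⊤ : ℕ∞) (truncatedHam ω L K r) := contDiff_truncatedHam hK
    have hB := contDiff_shift hω hF (1 / 2)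
    have hA := contDiff_shift hω hF (-(1 / 2))
    have hRs : ContDiff ℝ (⊤ : ℕ∞) fun x => H (shift ω hω F (1 / 2) x) -
        truncatedHam ω L K r (shift ω hω F (-(1 / 2)) x) := (hH.comp hB).sub (hN.comp hA)
    obtain ⟨P, hP⟩ := exists_diag_isBigO hRs.contDiffAt hR
    have hshift : ∀ c γ x, shift ω hω F c ((ρ γ : V →L[ℝ] V) x) =
        (ρ γ : V →L[ℝ] V) (shift ω hω F c x) := fun c γ x =>
      shift_map hω (units_sign_mul_self _) (hρω γ) hF (hFeq γ) c x
    -- The error has the symmetry of `H`, and its leading homogeneous term inherits it by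
    -- uniqueness.
    have hPeq : ∀ γ x, (P fun _ => (ρ γ : V →L[ℝ] V) x) =
        (((σ₁ γ : ℤˣ) : ℤ) : ℝ) * (((σ₂ γ : ℤˣ) : ℤ) : ℝ) * P fun _ => x := by
      intro γ x
      set c := (((σ₁ γ : ℤˣ) : ℤ) : ℝ) * (((σ₂ γ : ℤˣ) : ℤ) : ℝ) with hc
      have hg : Tendsto (fun x => (ρ γ : V →L[ℝ] V) x) (𝓝 0) (𝓝 0) := by
        simpa using (ρ γ : V →L[ℝ] V).continuous.tendsto 0
      have h1 := (hP.comp_tendsto hg).trans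
        (((ρ γ : V →L[ℝ] V).isBigO_id (𝓝 0)).norm_norm.pow (r + 1 + 1))
      have h2 := (hP.const_mul_left c).sub h1
      have := diag_eq_zero_of_isBigO (M := P.compContinuousLinearMap (fun _ => (ρ γ : V →L[ℝ] V)) -
        c • P) (h2.congr_left fun y => ?_) x
      · simpa [sub_eq_zero] using this
      · simp only [Function.comp_apply, sub_apply, smul_apply, smul_eq_mul,
          ContinuousMultilinearMap.compContinuousLinearMap_apply, hshift, hHeq]
        rw [truncatedHam_map (hρω γ) (hL γ) fun k hk => hKeq k hk γ]
        ring
    obtain ⟨f, Q, hPfQ, hfeq, hQeq, hQS⟩ := exists_homological ρ hρ σ₁ σ₂ hσ₁ hL hS P hPeq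
    have hf : ContDiff ℝ (⊤ : ℕ∞) fun x => f fun _ => x := contDiff_diag f
    have hF' := hF.add hf
    have hF3' : (fun x => F x + f fun _ => x) =O[𝓝 0] fun x => ‖x‖ ^ 3 :=
      hF3.add ((isBigO_diag f _).trans (isBigO_norm_pow_of_le (by omega)))
    let K' := Function.update K (r + 1) fun x => Q fun _ => x
    have hK'r : ∀ k ∈ Finset.Icc 3 (r + 1),
        (k = r + 1 ∧ K' k = fun x => Q fun _ => x) ∨ (k ∈ Finset.Icc 3 r ∧ K' k = K k) := by
      intro k hk
      rcases eq_or_ne k (r + 1) with rfl | h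
      · exact .inl ⟨rfl, Function.update_self ..⟩
      · refine .inr ⟨?_, Function.update_of_ne h ..⟩
        rw [Finset.mem_Icc] at hk ⊢
        omega
    have hNK : ∀ x, truncatedHam ω L K' (r + 1) x = truncatedHam ω L K r x + Q fun _ => x := by
      intro x
      rw [truncatedHam, truncatedHam, ← Finset.insert_Icc_right_eq_Icc_add_one (by omega),
        Finset.sum_insert (by simp), add_comm (K' (r + 1) x), ← add_assoc]
      congr 1
      · congr 1
        refine Finset.sum_congr rfl fun k hk => ?_
        have := (Finset.mem_Icc.1 hk).2
        rw [show K' k = K k from Function.update_of_ne (by omega) ..]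
      · rw [show K' (r + 1) = fun x => Q fun _ => x from Function.update_self ..]
    refine ⟨fun x => F x + f fun _ => x, K', hF', hF3', fun γ x => ?_, fun k hk => ?_,
      fun k hk => ?_, fun k hk => ?_, ?_⟩
    · simp only [hFeq, hfeq]
      ring
    · rcases hK'r k hk with ⟨rfl, h⟩ | ⟨h, h'⟩
      · exact h ▸ ⟨Q, fun _ => rfl⟩
      · exact h' ▸ hK k h
    · rcases hK'r k hk with ⟨rfl, h⟩ | ⟨h, h'⟩
      · exact h ▸ hQeq
      · exact h' ▸ hKeq k h
    · rcases hK'r k hk with ⟨rfl, h⟩ | ⟨h, h'⟩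
      · exact h ▸ hQS
      · exact h' ▸ hKS k h
    · have hXf : hamiltonianVF ω hω (fun x => f fun _ => x) =O[𝓝 0] fun x => ‖x‖ ^ r :=
        hamiltonianVF_isBigO hω hf.contDiffAt (isBigO_diag f _)
      have hB1 := shift_sub_isBigO hω hF hF3 (1 / 2)
      have hA1 := shift_sub_isBigO hω hF hF3 (-(1 / 2))
      have hB2 := shift_sub_isBigO hω hF' hF3' (1 / 2)
      have hA2 := shift_sub_isBigO hω hF' hF3' (-(1 / 2))
      have hΛ : ∀ {Z : V → V}, ((fun x => Z x - x) =O[𝓝 0] fun x => ‖x‖ ^ 2) →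
          (fun x => quadraticDual ω L (Z x) - quadraticDual ω L x) =O[𝓝 0] fun x => ‖x‖ ^ 2 :=
        fun hZ => (((quadraticDual ω L).isBigO_comp _ _).trans hZ).congr_left fun x => by
          rw [map_sub]
      -- To order `r + 2`, the new `f` acts only through the quadratic part of `H` and of `N`: each
      -- of `e1`, `e2` has linear term `-df(L x)/2`. In `e3` the argument of `Q` is replaced by `x`.
      have e1 := sub_sub_isBigO (m := r) (.of_forall fun z => hH.differentiable (by simp) z) hHL
        (isBigO_norm_of_sub hB2) (isBigO_norm_of_sub hB1) (hΛ hB2) (hΛ hB1)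
        ((hXf.const_smul_left (1 / 2 : ℝ)).congr_left fun x => by
          rw [shift_add hω hF hf, add_sub_cancel_left]; rfl)
      have e2 := sub_sub_isBigO (m := r) (.of_forall fun z => hN.differentiable (by simp) z)
        (fderiv_truncatedHam_isBigO hLs hK)
        (isBigO_norm_of_sub hA1) (isBigO_norm_of_sub hA2) (hΛ hA1) (hΛ hA2)
        ((hXf.const_smul_left (1 / 2 : ℝ)).congr_left fun x => by
          rw [shift_add hω hF hf, Pi.smul_apply]; module)
      have e3 := sub_sub_isBigO (m := 2) (p := r) (Φ := fun x => Q fun _ => x) (Λ := 0) (Z₁ := id)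
        (.of_forall fun z => (hasFDerivAt_diag Q z).differentiableAt)
        (by simpa using fderiv_isBigO (contDiff_diag Q).contDiffAt (isBigO_diag Q _))
        (isBigO_refl _ _).norm_right (isBigO_norm_of_sub hA2)
        (by simpa using isBigO_zero _ _) (by simpa using isBigO_zero _ _)
        (hA2.neg_left.congr_left fun x => neg_sub _ _)
      rw [add_comm 2 r] at e1 e2
      refine (((hP.add e1).add e2).add e3).congr_left fun x => ?_
      have hx := hPfQ x
      have h1 : ω (L x) (hamiltonianVF ω hω (fun x => f fun _ => x) x) =
          -fderiv ℝ (fun x => f fun _ => x) x (L x) := by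
        rw [hωs, apply_hamiltonianVF]
      rw [hNK]
      have h2 := shift_add hω hF hf (1 / 2) x
      have h3 := shift_add hω hF hf (-(1 / 2)) x
      have h4 : quadraticDual ω L x (shift ω hω (fun x => F x + f fun _ => x) (1 / 2) x -
          shift ω hω F (1 / 2) x) = -(1 / 2) * fderiv ℝ (fun x => f fun _ => x) x (L x) := by
        rw [h2, add_sub_cancel_left, map_smul, quadraticDual_apply, h1, smul_eq_mul]
        ring
      have h5 : quadraticDual ω L x (shift ω hω F (-(1 / 2)) x -
          shift ω hω (fun x => F x + f fun _ => x) (-(1 / 2)) x) =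
            -(1 / 2) * fderiv ℝ (fun x => f fun _ => x) x (L x) := by
        rw [h3, sub_add_cancel_left, map_neg, map_smul, quadraticDual_apply, h1, smul_eq_mul]
        ring
      simp only [h4, h5, zero_apply, id]
      -- The two halves add up to `-df(L x)`, which together with `-Q` cancels `P`.
      linear_combination -hx

end NormalForm

/-! ### The midpoint map as a symplectic equivariant diffeomorphism -/

section Change

variable {V : Type*} [NormedAddCommGroup V] [InnerProductSpace ℝ V]
variable {Γ : Type*} [Group Γ]

/-- An open set contains with `0` an invariant open neighbourhood of `0`. -/
theorem isOpen_forall_rep_mem [TopologicalSpace Γ] [CompactSpace Γ] {ρ : Γ →* GLV V}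
    (hρ : Continuous ρ) {W : Set V} (hW : IsOpen W) :
    IsOpen {x | ∀ γ, (ρ γ : V →L[ℝ] V) x ∈ W} := by
  have hc : Continuous fun p : Γ × V => (ρ p.1 : V →L[ℝ] V) p.2 :=
    (Units.continuous_val.comp (hρ.comp continuous_fst)).clm_apply continuous_snd
  -- The complement is the projection of a closed set along the compact factor `Γ`.
  have h := isClosedMap_snd_of_compactSpace (X := Γ) _ (hW.preimage hc).isClosed_compl
  convert h.isOpen_compl using 1
  ext x
  simp

variable [FiniteDimensional ℝ V]
variable {ω : LinearMap.BilinForm ℝ V} (hω : ω.Nondegenerate)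

theorem contDiffAt_symm_of_isUnit {e : OpenPartialHomeomorph V V} {y : V} (hy : y ∈ e.target)
    (he : ContDiffAt ℝ (⊤ : ℕ∞) e (e.symm y)) (hu : IsUnit (fderiv ℝ e (e.symm y))) :
    ContDiffAt ℝ (⊤ : ℕ∞) e.symm y := by
  have := FiniteDimensional.complete ℝ V
  obtain ⟨u, hu⟩ := hu
  refine e.contDiffAt_symm (f₀' := ContinuousLinearEquiv.ofUnit u) hy ?_ he
  have h := (he.differentiableAt (by simp)).hasFDerivAt
  rw [← hu] at h
  exact h

/-- The derivative of a Hamiltonian vector field is an infinitesimally symplectic operator. -/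
theorem apply_fderiv_hamiltonianVF {F : V → ℝ} (hF : ContDiff ℝ (⊤ : ℕ∞) F) (x u v : V) :
    ω (fderiv ℝ (hamiltonianVF ω hω F) x u) v = ω (fderiv ℝ (hamiltonianVF ω hω F) x v) u := by
  have hX := ((contDiff_hamiltonianVF hω hF).differentiable (by simp) x).hasFDerivAt
  have h2 : HasFDerivAt (fderiv ℝ F)
      (ω.toContinuousBilinearMap.comp (fderiv ℝ (hamiltonianVF ω hω F) x)) x := by
    refine (ω.toContinuousBilinearMap.hasFDerivAt.comp x hX).congr_of_eventuallyEq
      (.of_forall fun y => ?_)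
    ext w
    exact (apply_hamiltonianVF ω hω F y w).symm
  -- The pairing of `dX_F` with `ω` is the Hessian of `F`, which is symmetric.
  exact second_derivative_symmetric
    (fun y => (hF.differentiable (by simp) y).hasFDerivAt) h2 u v

theorem fderiv_shift {F : V → ℝ} (hF : ContDiff ℝ (⊤ : ℕ∞) F) (c : ℝ) (x u : V) :
    fderiv ℝ (shift ω hω F c) x u = u + c • fderiv ℝ (hamiltonianVF ω hω F) x u := by
  have hX := ((contDiff_hamiltonianVF hω hF).differentiable (by simp) x).hasFDerivAt
  have h : HasFDerivAt (shift ω hω F c) _ x := (hasFDerivAt_id x).add (hX.const_smul c)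
  rw [h.fderiv]
  rfl

/-- The Cayley transform of an infinitesimally symplectic operator is symplectic. -/
theorem apply_fderiv_shift (hωs : ∀ u v, ω u v = -ω v u) {F : V → ℝ}
    (hF : ContDiff ℝ (⊤ : ℕ∞) F) (c : ℝ) (x u v : V) :
    ω (fderiv ℝ (shift ω hω F c) x u) (fderiv ℝ (shift ω hω F c) x v) =
      ω (fderiv ℝ (shift ω hω F (-c)) x u) (fderiv ℝ (shift ω hω F (-c)) x v) := by
  have h1 := apply_fderiv_hamiltonianVF hω hF x u v
  have h2 := hωs u (fderiv ℝ (hamiltonianVF ω hω F) x v)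
  simp only [fderiv_shift hω hF, map_add, map_smul, LinearMap.add_apply, LinearMap.smul_apply,
    smul_eq_mul]
  -- The terms in `c²` agree on both sides, and those linear in `c` cancel by infinitesimal
  -- symplecticity.
  linear_combination 2 * c * h1 + 2 * c * h2

theorem shift_zero_and_fderiv {F : V → ℝ} (hF : ContDiff ℝ (⊤ : ℕ∞) F)
    (hF3 : F =O[𝓝 0] fun x => ‖x‖ ^ 3) (c : ℝ) :
    shift ω hω F c 0 = 0 ∧ HasFDerivAt (shift ω hω F c) (ContinuousLinearMap.id ℝ V) 0 := by
  have h := shift_sub_isBigO hω hF hF3 c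
  have h0 : shift ω hω F c 0 = 0 := by
    obtain ⟨C, hC⟩ := h.bound
    simpa using hC.self_of_nhds
  refine ⟨h0, ?_⟩
  have h1 : HasFDerivAt (fun x => shift ω hω F c x - x) (0 : V →L[ℝ] V) 0 :=
    IsBigO.hasFDerivAt (n := 2) (by simpa using h) one_lt_two
  have h2 := h1.add (hasFDerivAt_id (0 : V))
  rw [zero_add] at h2
  exact h2.congr_of_eventuallyEq (.of_forall fun x => by simp)

/-- The midpoint transformation `x - X_F(x)/2 ↦ x + X_F(x)/2` generated by a function `F` is a
symplectic equivariant change of coordinates near the origin. -/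
theorem exists_midpointChange [TopologicalSpace Γ] [CompactSpace Γ]
    (hωs : ∀ u v, ω u v = -ω v u) {ρ : Γ →* GLV V} (hρ : Continuous ρ)
    {σ : Γ →* ℤˣ} (hρω : IsSemisymplectic ω ρ σ) {F : V → ℝ} (hF : ContDiff ℝ (⊤ : ℕ∞) F)
    (hF3 : F =O[𝓝 0] fun x => ‖x‖ ^ 3)
    (hFeq : ∀ γ x, F ((ρ γ : V →L[ℝ] V) x) = (((σ γ : ℤˣ) : ℤ) : ℝ) * F x) :
    ∃ (ξ : OpenPartialHomeomorph V V) (a : V → V), IsSymplecticEquivariantChange ω ρ ξ ∧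
      (∀ y ∈ ξ.source, shift ω hω F (-(1 / 2)) (a y) = y ∧ ξ y = shift ω hω F (1 / 2) (a y)) ∧
      Tendsto a (𝓝 0) (𝓝 0) ∧ a =O[𝓝 0] fun y => ‖y‖ := by
  have := FiniteDimensional.complete ℝ V
  set A := shift ω hω F (-(1 / 2)) with hAdef
  set B := shift ω hω F (1 / 2) with hBdef
  have hA : ContDiff ℝ (⊤ : ℕ∞) A := contDiff_shift hω hF _
  have hB : ContDiff ℝ (⊤ : ℕ∞) B := contDiff_shift hω hF _
  obtain ⟨hA0, hA1⟩ : A 0 = 0 ∧ HasFDerivAt A (ContinuousLinearMap.id ℝ V) 0 :=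
    shift_zero_and_fderiv hω hF hF3 _
  obtain ⟨hB0, hB1⟩ : B 0 = 0 ∧ HasFDerivAt B (ContinuousLinearMap.id ℝ V) 0 :=
    shift_zero_and_fderiv hω hF hF3 _
  have hAγ : ∀ γ x, A ((ρ γ : V →L[ℝ] V) x) = (ρ γ : V →L[ℝ] V) (A x) := fun γ x =>
    shift_map hω (units_sign_mul_self _) (hρω γ) hF (hFeq γ) _ x
  have hBγ : ∀ γ x, B ((ρ γ : V →L[ℝ] V) x) = (ρ γ : V →L[ℝ] V) (B x) := fun γ x =>
    shift_map hω (units_sign_mul_self _) (hρω γ) hF (hFeq γ) _ x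
  let eA := hA.contDiffAt.toOpenPartialHomeomorph A
    (f' := ContinuousLinearEquiv.refl ℝ V) hA1 (by simp)
  let eB := hB.contDiffAt.toOpenPartialHomeomorph B
    (f' := ContinuousLinearEquiv.refl ℝ V) hB1 (by simp)
  have hA0s : (0 : V) ∈ eA.source := hA.contDiffAt.mem_toOpenPartialHomeomorph_source _ _
  have hB0s : (0 : V) ∈ eB.source := hB.contDiffAt.mem_toOpenPartialHomeomorph_source _ _
  -- On `W₀` both maps lie in the domains of their local inverses and have invertible derivatives;
  -- `W` is its largest invariant subset.
  let W₀ : Set V := (eA.source ∩ eB.source) ∩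
    ({x | IsUnit (fderiv ℝ A x)} ∩ {x | IsUnit (fderiv ℝ B x)})
  have hunit : ∀ {C : V → V}, ContDiff ℝ (⊤ : ℕ∞) C → IsOpen {x | IsUnit (fderiv ℝ C x)} :=
    fun hC => Units.isOpen.preimage (hC.continuous_fderiv (by simp))
  have hW₀ : IsOpen W₀ :=
    (eA.open_source.inter eB.open_source).inter ((hunit hA).inter (hunit hB))
  have h0W₀ : (0 : V) ∈ W₀ := by
    refine ⟨⟨hA0s, hB0s⟩, ?_, ?_⟩
    · rw [Set.mem_ofPred_eq, hA1.fderiv]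
      exact isUnit_one
    · rw [Set.mem_ofPred_eq, hB1.fderiv]
      exact isUnit_one
  let W : Set V := {x | ∀ γ, (ρ γ : V →L[ℝ] V) x ∈ W₀}
  have hW : IsOpen W := isOpen_forall_rep_mem hρ hW₀
  have h0W : (0 : V) ∈ W := fun γ => by rwa [map_zero]
  have hWγ : ∀ γ, ∀ x ∈ W, (ρ γ : V →L[ℝ] V) x ∈ W := fun γ x hx δ => by
    rw [← rep_mul]
    exact hx _
  have hWW₀ : ∀ x ∈ W, x ∈ W₀ := fun x hx => by simpa using hx 1
  let e := eA.restrOpen W hW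
  have hes : ∀ x ∈ W, x ∈ e.source := fun x hx => ⟨(hWW₀ x hx).1.1, hx⟩
  let ξ : OpenPartialHomeomorph V V := e.symm.trans eB
  have heA : ∀ x, e x = A x := fun _ => rfl
  have hξB : ∀ y, ξ y = B (e.symm y) := fun _ => rfl
  have hξs : ∀ x ∈ W, A x ∈ ξ.source ∧ e.symm (A x) = x := by
    intro x hx
    have h1 : e.symm (A x) = x := e.left_inv (hes x hx)
    refine ⟨?_, h1⟩
    rw [OpenPartialHomeomorph.trans_source]
    refine ⟨e.map_source (hes x hx), ?_⟩
    rw [Set.mem_preimage, h1]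
    exact (hWW₀ x hx).1.2
  have hξW : ∀ y ∈ ξ.source, e.symm y ∈ W ∧ A (e.symm y) = y ∧ y ∈ e.target := by
    intro y hy
    rw [OpenPartialHomeomorph.trans_source] at hy
    exact ⟨(e.map_target hy.1).2, e.right_inv hy.1, hy.1⟩
  have hsymm : ∀ y ∈ ξ.source, ContDiffAt ℝ (⊤ : ℕ∞) e.symm y := fun y hy =>
    contDiffAt_symm_of_isUnit (hξW y hy).2.2 hA.contDiffAt (hWW₀ _ (hξW y hy).1).2.1
  have hξc : ∀ y ∈ ξ.source, ContDiffAt ℝ (⊤ : ℕ∞) ξ y := fun y hy =>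
    hB.contDiffAt.comp y (hsymm y hy)
  have hchain : ∀ x ∈ W, ∀ u, fderiv ℝ ξ (A x) (fderiv ℝ A x u) = fderiv ℝ B x u := by
    intro x hx u
    have h1 : HasFDerivAt (fun z => ξ (A z)) ((fderiv ℝ ξ (A x)).comp (fderiv ℝ A x)) x :=
      (((hξc _ (hξs x hx).1).differentiableAt (by simp)).hasFDerivAt).comp x
        (hA.differentiable (by simp) x).hasFDerivAt
    have h2 : (fun z => ξ (A z)) =ᶠ[𝓝 x] B := by
      filter_upwards [hW.mem_nhds hx] with z hz
      rw [hξB, (hξs z hz).2]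
    exact congrArg (fun T : V →L[ℝ] V => T u)
      (h1.unique ((hB.differentiable (by simp) x).hasFDerivAt.congr_of_eventuallyEq h2))
  have h0s : (0 : V) ∈ ξ.source := hA0 ▸ (hξs 0 h0W).1
  have h0e : e.symm 0 = 0 := by
    have := (hξs 0 h0W).2
    rwa [hA0] at this
  refine ⟨ξ, e.symm, ⟨h0s, ?_, fun y hy => (hξc y hy).contDiffWithinAt, fun z hz => ?_, ?_, ?_, ?_,
    ?_⟩, fun y hy => ⟨(hξW y hy).2.1, rfl⟩, ?_, ?_⟩
  · rw [hξB, h0e, hB0]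
  · have hy := ξ.map_target hz
    have hzB : z ∈ eB.target := hz.1
    have hinv : eB.symm z = e.symm (ξ.symm z) := by
      conv_lhs => rw [← ξ.right_inv hz]
      exact eB.left_inv (hWW₀ _ (hξW _ hy).1).1.2
    have h1 : ContDiffAt ℝ (⊤ : ℕ∞) eB.symm z := by
      refine contDiffAt_symm_of_isUnit hzB hB.contDiffAt ?_
      rw [hinv]
      exact (hWW₀ _ (hξW _ hy).1).2.2
    exact (hA.contDiffAt.comp z h1).contDiffWithinAt
  · ext u
    have := hchain 0 h0W u
    rwa [hA0, hA1.fderiv, hB1.fderiv] at this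
  · intro y hy u v
    obtain ⟨hx, hxy, -⟩ := hξW y hy
    -- Every vector is `dA u`, and `dξ` sends it to `dB u`; it remains to compare `ω` on `dA` and on
    -- `dB`.
    obtain ⟨T, hT⟩ := (hWW₀ _ hx).2.1
    have hsurj : ∀ w, ∃ u, fderiv ℝ A (e.symm y) u = w := fun w =>
      ⟨((T⁻¹ : GLV V) : V →L[ℝ] V) w, by
        rw [← hT]
        exact congrArg (fun S : V →L[ℝ] V => S w) (Units.mul_inv T)⟩
    obtain ⟨u, rfl⟩ := hsurj u
    obtain ⟨v, rfl⟩ := hsurj v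
    have hu := hchain _ hx u
    have hv := hchain _ hx v
    rw [hxy] at hu hv
    rw [hu, hv]
    exact apply_fderiv_shift hω hωs hF (1 / 2) _ u v
  · intro γ y hy
    obtain ⟨hx, hxy, -⟩ := hξW y hy
    rw [← hxy, ← hAγ]
    exact (hξs _ (hWγ γ _ hx)).1
  · intro γ y hy
    obtain ⟨hx, hxy, -⟩ := hξW y hy
    have h1 : e.symm ((ρ γ : V →L[ℝ] V) y) = (ρ γ : V →L[ℝ] V) (e.symm y) := by
      conv_lhs => rw [← hxy, ← hAγ]
      exact (hξs _ (hWγ γ _ hx)).2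
    rw [hξB, hξB, h1, hBγ]
  · have := (hsymm 0 h0s).continuousAt.tendsto
    rwa [h0e] at this
  · have := ((hsymm 0 h0s).differentiableAt (by simp)).isBigO_sub
    simp only [h0e, sub_zero] at this
    exact this.norm_right

end Change

/-! ### Symmetry inherited by the linear part, the Hamiltonian and the multiplier -/

section Linearization

variable {V : Type*} [NormedAddCommGroup V] [InnerProductSpace ℝ V]
variable {Γ : Type*} [Group Γ]

theorem linearization_map {X : V → V} {L : V →L[ℝ] V} (hL : HasFDerivAt X L 0) (g : V →L[ℝ] V)
    {c : ℝ} (hX : ∀ x, X (g x) = c • g (X x)) (x : V) : L (g x) = c • g (L x) := by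
  have h1 : HasFDerivAt (fun x => X (g x)) (L.comp g) 0 := by
    refine HasFDerivAt.comp 0 (g := X) ?_ g.hasFDerivAt
    rwa [map_zero]
  have h2 : HasFDerivAt (fun x => c • g (X x)) (c • g.comp L) 0 :=
    (g.hasFDerivAt.comp 0 hL).const_smul c
  rw [← funext hX] at h2
  exact congrArg (fun T : V →L[ℝ] V => T x) (h1.unique h2)

theorem sub_linearization_isBigO [CompleteSpace V] {X : V → V} (hX : ContDiff ℝ (⊤ : ℕ∞) X)
    (hX0 : X 0 = 0) {L : V →L[ℝ] V} (hL : HasFDerivAt X L 0) :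
    (fun x => X x - L x) =O[𝓝 0] fun x => ‖x‖ ^ 2 := by
  refine (taylor_isBigO hX.contDiffAt 1).congr_left fun x => ?_
  simp [Finset.sum_range_succ, hX0, hL.fderiv]

theorem isSymplecticEquivariantChange_refl (ω : LinearMap.BilinForm ℝ V) (ρ : Γ →* GLV V) :
    IsSymplecticEquivariantChange ω ρ (OpenPartialHomeomorph.refl V) where
  zero_mem := Set.mem_univ _
  map_zero := rfl
  contDiffOn := contDiffOn_id
  contDiffOn_symm := contDiffOn_id
  fderiv_zero := fderiv_id
  symplectic y _ u v := by
    have h : fderiv ℝ (OpenPartialHomeomorph.refl V) y = .id ℝ V := fderiv_id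
    rw [h]
    rfl
  invariant _ _ _ := Set.mem_univ _
  equivariant _ _ _ := rfl

variable {ω : LinearMap.BilinForm ℝ V}

/-- A Hamiltonian that vanishes at the origin is semiinvariant if its vector field is
semiequivariant. -/
theorem hamiltonian_map {H : V → ℝ} (hH : Differentiable ℝ H) (hH0 : H 0 = 0) {X : V → V}
    (hX : ∀ x v, ω (X x) v = fderiv ℝ H x v) {g : V →L[ℝ] V} {s c : ℝ}
    (hg : ∀ u v, ω (g u) (g v) = s * ω u v) (hXg : ∀ x, X (g x) = c • g (X x)) (x : V) :
    H (g x) = s * c * H x := by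
  have hd : ∀ x, HasFDerivAt (fun x => H (g x) - s * c * H x)
      ((fderiv ℝ H (g x)).comp g - (s * c) • fderiv ℝ H x) x := fun x =>
    ((hH (g x)).hasFDerivAt.comp x g.hasFDerivAt).sub ((hH x).hasFDerivAt.const_mul (s * c))
  -- The defect `H(g x) - s c H(x)` has zero derivative and vanishes at the origin.
  have h := is_const_of_fderiv_eq_zero (𝕜 := ℝ) (fun x => (hd x).differentiableAt)
    (fun x => by
      rw [(hd x).fderiv]
      ext v
      simp only [sub_apply, smul_apply, ContinuousLinearMap.comp_apply, ← hX, hXg, map_smul,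
        LinearMap.smul_apply, hg, smul_eq_mul, zero_apply]
      ring) x 0
  simpa [hH0, sub_eq_zero] using h

/-- The multiplier of a continuous semisymplectic action is continuous. -/
theorem continuous_multiplier [FiniteDimensional ℝ V] [Nontrivial V] (hω : ω.Nondegenerate)
    [TopologicalSpace Γ] {ρ : Γ →* GLV V} (hρ : Continuous ρ) {σ : Γ →* ℤˣ}
    (hρω : IsSemisymplectic ω ρ σ) : Continuous fun γ => (((σ γ : ℤˣ) : ℤ) : ℝ) := by
  -- For a pair with `ω u v ≠ 0`, the multiplier is the quotient `ω(γ u, γ v) / ω(u, v)`. Its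
  -- continuity makes the Haar average integrable.
  obtain ⟨u, hu⟩ := exists_ne (0 : V)
  obtain ⟨v, hv⟩ : ∃ v, ω u v ≠ 0 := by
    by_contra! h
    exact hu (eq_of_apply_eq hω fun w => by rw [h, map_zero, LinearMap.zero_apply])
  have hc : ∀ w : V, Continuous fun γ => (ρ γ : V →L[ℝ] V) w := fun w =>
    (Units.continuous_val.comp hρ).clm_apply continuous_const
  have h : Continuous fun γ => ω.toContinuousBilinearMap ((ρ γ : V →L[ℝ] V) u)
      ((ρ γ : V →L[ℝ] V) v) / ω u v :=
    ((ω.toContinuousBilinearMap.continuous.comp (hc u)).clm_apply (hc v)).div_const _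
  refine h.congr fun γ => ?_
  rw [LinearMap.toContinuousBilinearMap_apply, hρω, mul_div_cancel_right₀ _ hv]

end Linearization

/-! ### Assembling the normal form -/

section Main

variable {V : Type*} [NormedAddCommGroup V] [InnerProductSpace ℝ V] [FiniteDimensional ℝ V]
variable {Γ : Type*} [Group Γ]

theorem mem_invariantPoly_semidirect {ρ : Γ →* GLV V} {L : V →L[ℝ] V}
    (hS : ∀ γ, ρ γ ∈ Subgroup.normalizer (groupS L : Set (GLV V))) {σ₁ σ₂ : Γ →* ℤˣ} {k : ℕ}
    {F : V → ℝ} (hF : IsHomogeneousPoly k F)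
    (hΓ : ∀ γ x, F ((ρ γ : V →L[ℝ] V) x) =
      (((σ₁ γ : ℤˣ) : ℤ) : ℝ) * (((σ₂ γ : ℤˣ) : ℤ) : ℝ) * F x)
    (hFS : ∀ s ∈ groupS L, ∀ x, F ((s : V →L[ℝ] V) x) = F x) :
    F ∈ invariantPoly k (semidirectAction ρ L hS) (tildeHom ρ L hS σ₁ * tildeHom ρ L hS σ₂) := by
  refine ⟨hF, fun p x => ?_⟩
  rw [MonoidHom.mul_apply, sign_mul]
  exact (hFS _ p.left.2 _).trans (hΓ p.right x)

/-- The induction starts at `r = 2`; for smaller `r` both sums of higher terms are empty. -/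
theorem truncatedVF_congr (ω : LinearMap.BilinForm ℝ V) (hω : ω.Nondegenerate) (L : V →L[ℝ] V)
    (K : ℕ → V → ℝ) (r : ℕ) :
    truncatedVF ω hω L K (max r 2) = truncatedVF ω hω L K r := by
  have h : Finset.Icc 3 (max r 2) = Finset.Icc 3 r := by
    ext k
    simp only [Finset.mem_Icc]
    omega
  ext y
  rw [truncatedVF, truncatedVF, h]

/-- The vector field of the Hamiltonian in the new coordinates is conjugate to the old one. -/
theorem isConjugateBy_hamiltonianVF {ω : LinearMap.BilinForm ℝ V} (hω : ω.Nondegenerate)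
    {ρ : Γ →* GLV V} {ξ : OpenPartialHomeomorph V V} (hξ : IsSymplecticEquivariantChange ω ρ ξ)
    {H : V → ℝ} (hH : Differentiable ℝ H) {X : V → V}
    (hX : ∀ x v, ω (X x) v = fderiv ℝ H x v) :
    IsConjugateBy ξ X (hamiltonianVF ω hω fun y => H (ξ y)) := by
  intro y hy
  have hd : HasFDerivAt ξ (fderiv ℝ ξ y) y :=
    ((hξ.contDiffOn.contDiffAt (ξ.open_source.mem_nhds hy)).differentiableAt (by simp)).hasFDerivAt
  -- A map preserving a nondegenerate form has no kernel.
  have hinj : Function.Injective (fderiv ℝ ξ y) := by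
    rw [injective_iff_map_eq_zero]
    intro u hu
    refine eq_of_apply_eq hω fun v => ?_
    rw [← hξ.symplectic y hy, hu, map_zero]
    rfl
  have hsurj : Function.Surjective (fderiv ℝ ξ y) :=
    LinearMap.surjective_of_injective (f := (fderiv ℝ ξ y : V →ₗ[ℝ] V)) hinj
  refine eq_of_apply_eq hω fun w => ?_
  obtain ⟨v, rfl⟩ := hsurj w
  have hc : HasFDerivAt (fun y => H (ξ y)) ((fderiv ℝ H (ξ y)).comp (fderiv ℝ ξ y)) y :=
    (hH (ξ y)).hasFDerivAt.comp y hd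
  rw [hξ.symplectic y hy, apply_hamiltonianVF, hc.fderiv, hX]
  rfl

end Main

end HamNormalForm

open Filter Asymptotics HamNormalForm in
theorem mainTheorem1
    {V : Type*} [NormedAddCommGroup V] [InnerProductSpace ℝ V] [FiniteDimensional ℝ V]
    (ω : LinearMap.BilinForm ℝ V) (hω_alt : ω.IsAlt) (hω : ω.Nondegenerate)
    {E : Type*} [NormedAddCommGroup E] [NormedSpace ℝ E] [FiniteDimensional ℝ E]
    {Γ : Type*} [Group Γ] [TopologicalSpace Γ] [ChartedSpace E Γ] [LieGroup 𝓘(ℝ, E) (⊤ : ℕ∞) Γ]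
    [CompactSpace Γ]
    (σ₁ σ₂ : Γ →* ℤˣ)
    (ρ : Γ →* HamNormalForm.GLV V) (hρ : Continuous ρ)
    (hρω : HamNormalForm.IsSemisymplectic ω ρ σ₁)
    (X : V → V) (hXham : HamNormalForm.IsHamiltonianOn ω X Set.univ)
    (hXeq : HamNormalForm.IsEquivariantOn ρ σ₂ X Set.univ)
    (hX0 : X 0 = 0) (L : V →L[ℝ] V) (hL : HasFDerivAt X L 0)
    (hS : ∀ γ, ρ γ ∈ Subgroup.normalizer
      (HamNormalForm.groupS L : Set (HamNormalForm.GLV V)))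
    (hSω : HamNormalForm.IsSymplecticAction ω (HamNormalForm.groupS L).subtype)
    (r : ℕ) :
    ∃ (ξ : OpenPartialHomeomorph V V) (Y : V → V) (K : ℕ → V → ℝ),
      HamNormalForm.IsSymplecticEquivariantChange ω ρ ξ ∧
      HamNormalForm.IsConjugateBy ξ X Y ∧
      (∀ k ∈ Finset.Icc 3 r,
        K k ∈ HamNormalForm.invariantPoly k (HamNormalForm.semidirectAction ρ L hS)
          (HamNormalForm.tildeHom ρ L hS σ₁ * HamNormalForm.tildeHom ρ L hS σ₂)) ∧
      (fun y => Y y - HamNormalForm.truncatedVF ω hω L K r y) =O[𝓝 0] (fun y => ‖y‖ ^ r) ∧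
      HamNormalForm.IsHamiltonianOn ω Y ξ.source ∧
      HamNormalForm.IsEquivariantOn ρ σ₂ Y ξ.source ∧
      HamNormalForm.IsHamiltonianOn ω (HamNormalForm.truncatedVF ω hω L K r) Set.univ ∧
      HamNormalForm.IsEquivariantOn ρ σ₂ (HamNormalForm.truncatedVF ω hω L K r) Set.univ := by
  -- When `V = 0` the form does not determine `σ₁`, whose continuity may fail; everything is then
  -- trivial.
  rcases subsingleton_or_nontrivial V with hV | hV
  · refine ⟨OpenPartialHomeomorph.refl V, X, 0, isSymplecticEquivariantChange_refl ω ρ,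
      fun _ _ => Subsingleton.elim _ _, fun k _ => ⟨⟨0, fun _ => rfl⟩, fun _ _ => by simp⟩, ?_,
      hXham, fun _ _ _ => Subsingleton.elim _ _, ?_, fun _ _ _ => Subsingleton.elim _ _⟩
    · exact (isBigO_zero _ _).congr_left fun _ => Subsingleton.elim _ _
    · exact ⟨0, contDiffOn_const, fun x _ v => by
        rw [Subsingleton.elim v 0, map_zero, map_zero]⟩
  have := FiniteDimensional.complete ℝ V
  have : IsTopologicalGroup Γ := topologicalGroup_of_lieGroup 𝓘(ℝ, E) (⊤ : ℕ∞)
  have hωs : ∀ u v, ω u v = -ω v u := fun u v => (hω_alt.neg_eq v u).symm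
  obtain ⟨H₀, hH₀, hXH₀⟩ := hXham
  rw [contDiffOn_univ] at hH₀
  -- A nonzero constant would break semiinvariance wherever `σ₁ σ₂ = -1`.
  let H : V → ℝ := fun x => H₀ x - H₀ 0
  have hH : ContDiff ℝ (⊤ : ℕ∞) H := hH₀.sub contDiff_const
  have hHd : Differentiable ℝ H := hH.differentiable (by simp)
  have hH0 : H 0 = 0 := sub_self _
  have hXH : ∀ x v, ω (X x) v = fderiv ℝ H x v := fun x v => by
    rw [hXH₀ x (Set.mem_univ x), fderiv_sub_const]
  have hXs : ContDiff ℝ (⊤ : ℕ∞) X := by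
    rw [← funext fun x => hamiltonianVF_eq_of_apply hω (hXH x)]
    exact contDiff_hamiltonianVF hω hH
  have hHeq : ∀ γ x, H ((ρ γ : V →L[ℝ] V) x) =
      (((σ₁ γ : ℤˣ) : ℤ) : ℝ) * (((σ₂ γ : ℤˣ) : ℤ) : ℝ) * H x := fun γ =>
    hamiltonian_map hHd hH0 hXH (hρω γ) fun x => hXeq γ x (Set.mem_univ x)
  have hLeq : ∀ γ x, L ((ρ γ : V →L[ℝ] V) x) =
      (((σ₂ γ : ℤˣ) : ℤ) : ℝ) • (ρ γ : V →L[ℝ] V) (L x) := fun γ =>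
    linearization_map hL _ fun x => hXeq γ x (Set.mem_univ x)
  have hXvf : hamiltonianVF ω hω H = X := funext fun x => hamiltonianVF_eq_of_apply hω (hXH x)
  have hLs : ∀ u v, ω (L u) v = ω (L v) u := fun u v => by
    have := apply_fderiv_hamiltonianVF hω hH 0 u v
    rwa [hXvf, hL.fderiv] at this
  have hHL : (fun x => fderiv ℝ H x - quadraticDual ω L x) =O[𝓝 0] fun x => ‖x‖ ^ 2 := by
    refine ((ω.toContinuousBilinearMap.isBigO_comp _ _).trans
      (sub_linearization_isBigO hXs hX0 hL)).congr_left fun x => ?_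
    ext v
    rw [map_sub, sub_apply, sub_apply, ← hXH]
    rfl
  obtain ⟨F, K, hF, hF3, hFeq, hK, hKeq, hKS, hR⟩ := exists_generatingFunction hω hωs ρ hρ σ₁ σ₂
    (continuous_multiplier hω hρ hρω) hρω hH hH0 hHeq hHL hLs hLeq hS (le_max_right r 2)
  obtain ⟨ξ, a, hξ, ha, ha0, haO⟩ := exists_midpointChange hω hωs hρ hρω hF hF3 hFeq
  have hr : ∀ k ∈ Finset.Icc 3 r, k ∈ Finset.Icc 3 (max r 2) := fun k hk => by
    rw [Finset.mem_Icc] at hk ⊢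
    omega
  have hξs : ∀ y ∈ ξ.source, ContDiffAt ℝ (⊤ : ℕ∞) (fun y => H (ξ y)) y := fun y hy =>
    hH.contDiffAt.comp y (hξ.contDiffOn.contDiffAt (ξ.open_source.mem_nhds hy))
  have hN : ContDiff ℝ (⊤ : ℕ∞) (truncatedHam ω L K (max r 2)) := contDiff_truncatedHam hK
  have hNvf : hamiltonianVF ω hω (truncatedHam ω L K (max r 2)) = truncatedVF ω hω L K r := by
    rw [funext (hamiltonianVF_truncatedHam hω hLs hK), truncatedVF_congr]
  have hs : ξ.source ∈ 𝓝 (0 : V) := ξ.open_source.mem_nhds hξ.zero_mem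
  refine ⟨ξ, hamiltonianVF ω hω fun y => H (ξ y), K, hξ, isConjugateBy_hamiltonianVF hω hξ hHd hXH,
    fun k hk => mem_invariantPoly_semidirect hS (hK k (hr k hk)) (hKeq k (hr k hk))
      (hKS k (hr k hk)), ?_, ?_, ?_, ?_, ?_⟩
  · have h1 : (fun y => H (ξ y) - truncatedHam ω L K (max r 2) y) =O[𝓝 0]
        fun y => ‖y‖ ^ (max r 2 + 1) := by
      refine ((hR.comp_tendsto ha0).trans (haO.norm_left.pow _)).congr' ?_ .rfl
      filter_upwards [hs] with y hy
      rw [Function.comp_apply, (ha y hy).1, (ha y hy).2]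
    have h2 := hamiltonianVF_isBigO hω ((hξs 0 hξ.zero_mem).sub hN.contDiffAt) h1
    refine (h2.trans (isBigO_norm_pow_of_le (le_max_left r 2))).congr' ?_ .rfl
    filter_upwards [hs] with y hy
    rw [← hNvf]
    simp only [hamiltonianVF_eq]
    rw [fderiv_fun_sub ((hξs y hy).differentiableAt (by simp))
      (hN.differentiable (by simp) y), map_sub]
  · exact ⟨fun y => H (ξ y), fun y hy => (hξs y hy).contDiffWithinAt,
      fun y _ v => apply_hamiltonianVF ω hω _ y v⟩
  · intro γ y hy
    rw [hamiltonianVF_map hω (units_sign_mul_self _) (hρω γ)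
      ((hξs _ (hξ.invariant γ y hy)).differentiableAt (by simp))
      ((hξs y hy).differentiableAt (by simp)) (c := (((σ₁ γ : ℤˣ) : ℤ) : ℝ) *
        (((σ₂ γ : ℤˣ) : ℤ) : ℝ)), ← mul_assoc, units_sign_mul_self, one_mul]
    filter_upwards [ξ.open_source.mem_nhds hy] with z hz
    rw [hξ.equivariant γ z hz, hHeq]
  · exact ⟨_, hN.contDiffOn, fun y _ v => by rw [← hNvf, apply_hamiltonianVF]⟩
  · intro γ y _
    rw [← hNvf, hamiltonianVF_map hω (units_sign_mul_self _) (hρω γ) (hN.differentiable (by simp) _)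
      (hN.differentiable (by simp) _) (c := (((σ₁ γ : ℤˣ) : ℤ) : ℝ) *
        (((σ₂ γ : ℤˣ) : ℤ) : ℝ)), ← mul_assoc, units_sign_mul_self, one_mul]
    exact .of_forall (truncatedHam_map (hρω γ) (hLeq γ) fun k hk => hKeq k hk γ)
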